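/- Let $\mathrm{Nil}_3=\mathbb{E}(0,\tfrac12)$ be $\mathbb{R}^3$ with the Riemannian metric $dx^2+dy^2+\bigl(dz+\tfrac12(y\,dx-x\,dy)\bigr)^2$, and let $\pi(x,y,z)=(x,y)$, a Riemannian submersion onto $\mathbb{R}^2$ whose fibres are the orbits of the unit Killing field $\xi=\partial_z$. A geodesic is horizontal (resp. vertical) if it is everywhere orthogonal (resp. tangent) to $\xi$; the vertical geodesics are the fibres of $\pi$. The curve $\Gamma(t)=(0,t,0)$ is a horizontal geodesic. A straight line is an affine line of $\mathbb{R}^3$ (not necessarily a geodesic of $\mathrm{Nil}_3$). There is a family $\mathcal{H}_\mu$, $\mu\in\mathbb{R}$, of surfaces in $\mathrm{Nil}_3$ with the following properties. (i) Each $\mathcal{H}_\mu$ is the image of a smooth proper embedding $\Phi_\mu:\mathbb{R}^2\to\mathrm{Nil}_3$ that has zero mean curvature and whose induced Riemannian metric is complete. The family is continuous: for every $m\ge 0$ the $m$-th derivative of $\Phi_\mu$ at $p$ depends continuously on $(\mu,p)\in\mathbb{R}\times\mathbb{R}^2$. (ii) Each $\mathcal{H}_\mu$ is foliated by straight lines orthogonal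 to $\Gamma$ (it is the disjoint union of straight lines, one through each point of $\Gamma$, meeting $\Gamma$ orthogonally at that point and depending smoothly on it), and it contains a horizontal geodesic that meets $\Gamma$ orthogonally. Near the origin, the line of $\mathcal{H}_\mu$ through $(0,v,0)$ is $u\mapsto(u,v,u\,h(v))$ with $h(0)=0$ and $h'(0)=\mu$. (iii) If $-\frac12\le\mu\le\frac12$, then $\mathcal{H}_\mu$ is an entire graph, i.e. the image of a global smooth section of $\pi$. (iv) If $|\mu|>\frac12$, then $\mathcal{H}_\mu$ is a horizontal helicoid-type surface of axis $\Gamma$: the angle $\theta(v)$ that the line through $\Gamma(v)$ makes with $\Gamma'\times\xi$ in the oriented normal plane $(\Gamma'\times\xi,\xi)$ can be chosen as a smooth surjective function $\theta:\mathbb{R}\to\mathbb{R}$ with nowhere vanishing derivative, and $\mathcal{H}_\mu$ is invariant under the axial symmetry about each vertical geodesic that it contains. The two subfamilies $\mu>\frac12$ and $\mu<-\frac12$ have opposite directions of rotation: $\theta'>0$ everywhere if $\mu>\frac12$, and $\theta'<0$ everywhere if $\mu<-\frac12$. (v) If $|\mu|>\frac12$, there is a number $D(\mu)>0$ such that the vertical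 geodesics contained in $\mathcal{H}_\mu$ are exactly the fibres of $\pi$ over the points $\bigl(0,(k+\tfrac12)D(\mu)\bigr)$, $k\in\mathbb{Z}$, and the Riemannian distance in $\mathrm{Nil}_3$ between any two successive ones is $D(\mu)$. The function $D$ is a strictly decreasing bijection from $(\frac12,\infty)$ onto $(0,\infty)$ and a strictly increasing bijection from $(-\infty,-\frac12)$ onto $(0,\infty)$, with $D(\mu)\to0$ as $|\mu|\to\infty$ and $D(\mu)\to+\infty$ as $|\mu|\to\frac12$, $|\mu|>\frac12$. Thus each of the two subfamilies can be reparametrized by the distance between two successive vertical geodesics. -/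

import Mathlib

open Set Filter Topology
open scoped ContDiff ENNReal

/-! Nil₃ is the product ℝ³ with coordinates (x, y, z) = (p 0, p 1, p 2) and the Riemannian metric
dx² + dy² + (dz + (y dx - x dy) / 2)². Only the smooth structure of `Fin 3 → ℝ` is used; its
sup norm plays no role as a distance. -/

/-- The underlying manifold ℝ³ of Nil₃; tangent vectors are written in the coordinate basis. -/
abbrev Nil3 : Type := Fin 3 → ℝ

namespace Nil3

/-- The connection form dz + (y dx - x dy) / 2 at `p`, whose kernel is the horizontal plane. -/
noncomputable def vertForm (p V : Nil3) : ℝ := V 2 + (p 1 * V 0 - p 0 * V 1) / 2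

/-- The Riemannian metric of Nil₃ = 𝔼(0, 1/2). -/
noncomputable def metric (p V W : Nil3) : ℝ :=
  V 0 * W 0 + V 1 * W 1 + vertForm p V * vertForm p W

/-- E₁ = ∂x - (y/2) ∂z. -/
noncomputable def E1 (p : Nil3) : Nil3 := ![1, 0, -(p 1) / 2]

/-- E₂ = ∂y + (x/2) ∂z. -/
noncomputable def E2 (p : Nil3) : Nil3 := ![0, 1, p 0 / 2]

/-- The unit vertical Killing field ξ = E₃ = ∂z. -/
def xi : Nil3 := ![0, 0, 1]

/-- The cross product `V × ξ` at `p`, where (E₁, E₂, ξ) is a positive orthonormal frame. -/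
noncomputable def crossXi (p V : Nil3) : Nil3 := V 1 • E1 p - V 0 • E2 p

/-- Christoffel symbols of the first kind of the Levi-Civita connection:
`g (∇_U V, W)` at `p` for vector fields `U`, `V`, `W` with constant coordinates. -/
noncomputable def christoffel (p U V W : Nil3) : ℝ :=
  (fderiv ℝ (fun q => metric q V W) p U + fderiv ℝ (fun q => metric q U W) p V
    - fderiv ℝ (fun q => metric q U V) p W) / 2

/-! ### Geodesics -/

/-- Complete unit-speed geodesics: `∇_{γ'} γ' = 0`, tested against every tangent vector. -/
def IsGeodesic (γ : ℝ → Nil3) : Prop :=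
  ContDiff ℝ ∞ γ ∧ (∀ t, metric (γ t) (deriv γ t) (deriv γ t) = 1) ∧
    ∀ t W, metric (γ t) (deriv (deriv γ) t) W
      + christoffel (γ t) (deriv γ t) (deriv γ t) W = 0

/-- Geodesics that are everywhere orthogonal to ξ. -/
def IsHorizontalGeodesic (γ : ℝ → Nil3) : Prop :=
  IsGeodesic γ ∧ ∀ t, metric (γ t) (deriv γ t) xi = 0

/-- The set `L` is (the trace of) a complete geodesic that is everywhere tangent to ξ. -/
def IsVerticalGeodesic (L : Set Nil3) : Prop :=
  ∃ γ : ℝ → Nil3, IsGeodesic γ ∧ (∀ t, ∃ c : ℝ, deriv γ t = c • xi) ∧ L = range γ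

/-- The fibre of the projection (x, y, z) ↦ (x, y) over the point (a, b). -/
def fibre (a b : ℝ) : Set Nil3 := {p | p 0 = a ∧ p 1 = b}

/-- The axial symmetry (rotation of angle π) about the fibre over (a, b). It is the isometry of
Nil₃ that fixes this fibre pointwise and covers the rotation of angle π about (a, b). -/
def axialSymmetry (a b : ℝ) (p : Nil3) : Nil3 :=
  ![2 * a - p 0, 2 * b - p 1, p 2 + b * p 0 - a * p 1]

/-! ### Length and distance -/

/-- The Riemannian length of the restriction of `γ` to the interval [0, 1]. -/
noncomputable def length (γ : ℝ → Nil3) : ℝ≥0∞ :=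
  ∫⁻ t in Icc (0 : ℝ) 1, ENNReal.ofReal (Real.sqrt (metric (γ t) (deriv γ t) (deriv γ t)))

/-- The Riemannian distance of Nil₃. -/
noncomputable def dist (p q : Nil3) : ℝ≥0∞ :=
  ⨅ (γ : ℝ → Nil3) (_ : ContDiff ℝ 1 γ ∧ γ 0 = p ∧ γ 1 = q), length γ

/-- The Riemannian distance between two subsets of Nil₃. -/
noncomputable def setDist (A B : Set Nil3) : ℝ≥0∞ := ⨅ p ∈ A, ⨅ q ∈ B, dist p q

/-! ### Surfaces in Nil₃ parametrized by the plane -/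

/-- `φ` is a smooth proper embedding of the plane: an injective, proper, smooth immersion. -/
def IsProperEmbedding (φ : ℝ × ℝ → Nil3) : Prop :=
  ContDiff ℝ ∞ φ ∧ Function.Injective φ ∧ (∀ p, Function.Injective (fderiv ℝ φ p)) ∧
    IsProperMap φ

/-- The first fundamental form of `φ` at `p`. -/
noncomputable def firstForm (φ : ℝ × ℝ → Nil3) (p a b : ℝ × ℝ) : ℝ :=
  metric (φ p) (fderiv ℝ φ p a) (fderiv ℝ φ p b)

/-- The second fundamental form of `φ` at `p` with respect to the normal vector `n`, that is
`g (∇_{∂a φ} ∂b φ, n)`. -/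
noncomputable def secondForm (φ : ℝ × ℝ → Nil3) (p : ℝ × ℝ) (n : Nil3) (a b : ℝ × ℝ) : ℝ :=
  metric (φ p) (fderiv ℝ (fun q => fderiv ℝ φ q b) p a) n
    + christoffel (φ p) (fderiv ℝ φ p a) (fderiv ℝ φ p b) n

/-- The vector `n` is a unit normal to `φ` at `p`. -/
def IsUnitNormal (φ : ℝ × ℝ → Nil3) (p : ℝ × ℝ) (n : Nil3) : Prop :=
  metric (φ p) n n = 1 ∧ ∀ a, metric (φ p) (fderiv ℝ φ p a) n = 0

/-- The mean curvature (half of the trace of the second fundamental form with respect to the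
first one) of an immersion `φ` at `p` for the unit normal `n`. -/
noncomputable def meanCurvature (φ : ℝ × ℝ → Nil3) (p : ℝ × ℝ) (n : Nil3) : ℝ :=
  (firstForm φ p (1, 0) (1, 0) * secondForm φ p n (0, 1) (0, 1)
    - 2 * firstForm φ p (1, 0) (0, 1) * secondForm φ p n (1, 0) (0, 1)
    + firstForm φ p (0, 1) (0, 1) * secondForm φ p n (1, 0) (1, 0)) /
  (2 * (firstForm φ p (1, 0) (1, 0) * firstForm φ p (0, 1) (0, 1)
    - firstForm φ p (1, 0) (0, 1) ^ 2))

/-- The mean curvature of `φ` vanishes identically. -/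
def IsMinimal (φ : ℝ × ℝ → Nil3) : Prop :=
  ∀ p n, IsUnitNormal φ p n → meanCurvature φ p n = 0

/-- The intrinsic distance of the surface `φ`: infimum of the lengths of the curves inside it. -/
noncomputable def surfaceDist (φ : ℝ × ℝ → Nil3) (a b : ℝ × ℝ) : ℝ≥0∞ :=
  ⨅ (c : ℝ → ℝ × ℝ) (_ : ContDiff ℝ 1 c ∧ c 0 = a ∧ c 1 = b), length (φ ∘ c)

/-- The surface `φ` with its induced Riemannian metric is complete: every Cauchy sequence for the
intrinsic distance converges. -/
def IsCompleteSurface (φ : ℝ × ℝ → Nil3) : Prop :=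
  ∀ s : ℕ → ℝ × ℝ,
    (∀ ε : ℝ≥0∞, 0 < ε → ∃ N, ∀ m ≥ N, ∀ n ≥ N, surfaceDist φ (s m) (s n) < ε) →
      ∃ a, Tendsto (fun n => surfaceDist φ (s n) a) atTop (𝓝 0)

/-- A family of parametrized surfaces that depends continuously on the parameter, in the smooth
topology: all derivatives vary continuously, locally uniformly. -/
def IsContinuousFamily (Φ : ℝ → ℝ × ℝ → Nil3) : Prop :=
  ∀ m : ℕ, Continuous fun q : ℝ × (ℝ × ℝ) => iteratedFDeriv ℝ m (Φ q.1) q.2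

/-- `S` is a smooth entire vertical graph, i.e. a global section of (x, y, z) ↦ (x, y). -/
def IsEntireGraph (S : Set Nil3) : Prop :=
  ∃ w : ℝ × ℝ → ℝ, ContDiff ℝ ∞ w ∧ S = range fun q : ℝ × ℝ => (![q.1, q.2, w q] : Nil3)

/-! ### Surfaces ruled by straight lines along a horizontal geodesic -/

/-- The straight line of ℝ³ through `p` with direction `d`. -/
def straightLine (p d : Nil3) : Set Nil3 := range fun s : ℝ => p + s • d

/-- `S` is the disjoint union of straight lines, one through each point of the curve `γ`, that
meet `γ` orthogonally there and depend smoothly on the point. -/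
def IsFoliatedByOrthogonalLines (S : Set Nil3) (γ : ℝ → Nil3) : Prop :=
  ∃ d : ℝ → Nil3, ContDiff ℝ ∞ d ∧
    (∀ v, d v ≠ 0 ∧ metric (γ v) (deriv γ v) (d v) = 0) ∧
    (∀ v w, v ≠ w → Disjoint (straightLine (γ v) (d v)) (straightLine (γ w) (d w))) ∧
    S = ⋃ v, straightLine (γ v) (d v)

/-- `S` contains a horizontal geodesic that meets the curve `γ` orthogonally. -/
def ContainsOrthogonalHorizontalGeodesic (S : Set Nil3) (γ : ℝ → Nil3) : Prop :=
  ∃ α : ℝ → Nil3, IsHorizontalGeodesic α ∧ range α ⊆ S ∧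
    ∃ s v, α s = γ v ∧ metric (γ v) (deriv α s) (deriv γ v) = 0

/-- `S` is of horizontal helicoid type with axis the horizontal geodesic `γ`, and `ε` (1 or -1) is
its direction of rotation: it is the union of straight lines orthogonal to `γ`, where the line
through `γ v` makes the angle `θ v` with the horizontal direction `γ' × ξ` in the oriented normal
plane (γ' × ξ, ξ); these lines rotate monotonically (`θ'` has everywhere the sign of `ε`) and make
infinitely many turns in both ways along `γ`; and `S` is invariant under the axial symmetry about
each vertical geodesic that it contains. -/
def IsHorizontalHelicoid (S : Set Nil3) (γ : ℝ → Nil3) (ε : ℝ) : Prop :=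
  (∃ θ : ℝ → ℝ, ContDiff ℝ ∞ θ ∧ (∀ v, 0 < ε * deriv θ v) ∧ Function.Surjective θ ∧
    S = ⋃ v, straightLine (γ v)
      (Real.cos (θ v) • crossXi (γ v) (deriv γ v) + Real.sin (θ v) • xi)) ∧
  ∀ a b, fibre a b ⊆ S → axialSymmetry a b '' S = S

/-- The axis Γ, namely the y-axis. -/
def axis (t : ℝ) : Nil3 := ![0, t, 0]

/-- Near the origin `S` is swept out by the lines u ↦ (u, v, u h(v)) with `h 0 = 0`, `h' 0 = μ`. -/
def HasInitialRotation (S : Set Nil3) (μ : ℝ) : Prop :=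
  ∃ (δ : ℝ) (h : ℝ → ℝ), 0 < δ ∧ h 0 = 0 ∧ HasDerivAt h μ 0 ∧
    ∀ u v : ℝ, |v| < δ → (![u, v, u * h v] : Nil3) ∈ S

end Nil3

/-! The surface is `ruled θ`: the line through `axis v` makes the angle `θ v` with `E1` in the
normal plane. With ρ = θ' and c = cos² θ, the numerator of the mean curvature at distance u along a
line is u m (ρ' - sin θ cos θ (c - 3ρ)), where m is a component of the normal. So minimality follows
from a second order equation for θ (`isMinimal_ruled`), with θ(0) = 0 and θ'(0) = μ + 1/2.

Along solutions (ρ - c)² and 2ρ - c are both multiplied by the same factor, so (ρ - c)² / (2ρ - c)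
is a first integral, with value (μ - 1/2)² / (2μ) fixed by the initial data. Solving this quadratic
relation for ρ leaves a scalar autonomous equation, which is integrated by inverting the travel time
(`exists_autonomous_solution`). For |μ| > 1/2 the speed ρ is a π-periodic even function of θ of
constant sign: the lines turn forever, θ is symmetric about each vertical position, and a half turn
takes the time D = ∫₀^π dx / |ρ| (`exists_isHelicoidAngle`). For |μ| ≤ 1/2 the equation is solved
for tan θ, so cos θ never vanishes and the surface is a graph (`exists_angle_of_abs_le`).

The integral D decreases in the first integral K, tends to 0 as K → ∞ and diverges logarithmically
as K → 0; K itself increases with |μ| from 0 to ∞ (`firstIntegral`). Continuity in μ comes from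
Grönwall's inequality and the fact that derivatives of `ruled θ` are smooth functions of the point,
θ and ρ. Completeness holds because v and arsinh(u)/2 are 1-Lipschitz for the induced metric. -/

/-! ### Autonomous scalar equations -/

/-- The time that a solution of `x' = F x` with `x 0 = 0` needs to reach `y`. -/
noncomputable def travelTime (F : ℝ → ℝ) (y : ℝ) : ℝ := ∫ t in (0 : ℝ)..y, (F t)⁻¹

theorem travelTime_zero (F : ℝ → ℝ) : travelTime F 0 = 0 := by simp [travelTime]

theorem hasDerivAt_travelTime {F : ℝ → ℝ} (hF : Continuous F) (hpos : ∀ x, 0 < F x) (y : ℝ) :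
    HasDerivAt (travelTime F) (F y)⁻¹ y :=
  ((hF.inv₀ fun x => (hpos x).ne').integral_hasStrictDerivAt 0 y).hasDerivAt

theorem strictMono_travelTime {F : ℝ → ℝ} (hF : Continuous F) (hpos : ∀ x, 0 < F x) :
    StrictMono (travelTime F) :=
  strictMono_of_deriv_pos fun y => by
    rw [(hasDerivAt_travelTime hF hpos y).deriv]; exact inv_pos.2 (hpos y)

/-- The bound on `F` makes the travel time grow at least like y / M in both directions; this is what
rules out blow-up in finite time. -/
theorem surjective_travelTime {F : ℝ → ℝ} (hF : Continuous F) (hpos : ∀ x, 0 < F x) {M : ℝ}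
    (hM : ∀ x, F x ≤ M) : Function.Surjective (travelTime F) := by
  have hM0 : 0 < M := (hpos 0).trans_le (hM 0)
  have hd : ∀ y, HasDerivAt (fun y => travelTime F y - M⁻¹ * y) ((F y)⁻¹ - M⁻¹ * 1) y := fun y =>
    (hasDerivAt_travelTime hF hpos y).sub ((hasDerivAt_id y).const_mul _)
  have hmono : Monotone fun y => travelTime F y - M⁻¹ * y :=
    monotone_of_deriv_nonneg (fun y => (hd y).differentiableAt) fun y => by
      rw [(hd y).deriv, mul_one, sub_nonneg]
      exact inv_anti₀ (hpos y) (hM y)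
  have hcont : Continuous (travelTime F) :=
    continuous_iff_continuousAt.2 fun y => (hasDerivAt_travelTime hF hpos y).continuousAt
  refine hcont.surjective ?_ ?_
  · refine tendsto_atTop_mono' atTop ?_ (tendsto_id.const_mul_atTop (inv_pos.2 hM0))
    filter_upwards [eventually_ge_atTop 0] with y hy
    have := hmono hy
    simp only [travelTime_zero] at this
    simp only [id]
    linarith
  · refine tendsto_atBot_mono' atBot ?_ (tendsto_id.const_mul_atBot (inv_pos.2 hM0))
    filter_upwards [eventually_le_atBot 0] with y hy
    have := hmono hy
    simp only [travelTime_zero] at this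
    simp only [id]
    linarith

/-- Separation of variables: the solution is the inverse function of the travel time. -/
theorem exists_autonomous_solution {F : ℝ → ℝ} (hF : Continuous F) (hpos : ∀ x, 0 < F x) {M : ℝ}
    (hM : ∀ x, F x ≤ M) :
    ∃ x : ℝ → ℝ, (∀ v, HasDerivAt x (F (x v)) v) ∧ (∀ v, travelTime F (x v) = v) ∧
      ∀ y, x (travelTime F y) = y := by
  have hmono := strictMono_travelTime hF hpos
  let e : ℝ ≃o ℝ := hmono.orderIsoOfSurjective _ (surjective_travelTime hF hpos hM)
  have he : ∀ v, travelTime F (e.symm v) = v := fun v => e.apply_symm_apply v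
  refine ⟨e.symm, fun v => ?_, he, fun y => e.symm_apply_apply y⟩
  have h := (hasDerivAt_travelTime hF hpos (e.symm v)).of_local_left_inverse
    e.symm.continuous.continuousAt (inv_ne_zero (hpos _).ne') (Eventually.of_forall he)
  rwa [inv_inv] at h

theorem travelTime_reflect {F : ℝ → ℝ} (hF : Continuous F) (hpos : ∀ x, 0 < F x) {A : ℝ}
    (hA : ∀ x, F (2 * A - x) = F x) (y : ℝ) :
    travelTime F (2 * A - y) = 2 * travelTime F A - travelTime F y := by
  have hint : ∀ a b, IntervalIntegrable (fun t => (F t)⁻¹) MeasureTheory.volume a b :=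
    fun a b => (hF.inv₀ fun x => (hpos x).ne').intervalIntegrable a b
  have h := intervalIntegral.integral_comp_sub_left (a := y) (b := A) (fun t => (F t)⁻¹) (2 * A)
  simp only [hA] at h
  have h1 := intervalIntegral.integral_add_adjacent_intervals (hint 0 A) (hint A (2 * A - y))
  have h2 := intervalIntegral.integral_add_adjacent_intervals (hint 0 y) (hint y A)
  rw [show 2 * A - A = A by ring] at h
  simp only [travelTime]
  linarith

theorem travelTime_add_int_mul {F : ℝ → ℝ} (hF : Continuous F) (hpos : ∀ x, 0 < F x) {T : ℝ}
    (hT : Function.Periodic F T) (y : ℝ) (k : ℤ) :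
    travelTime F (y + k * T) = travelTime F y + k * travelTime F T := by
  have hint : ∀ a b, IntervalIntegrable (fun t => (F t)⁻¹) MeasureTheory.volume a b :=
    fun a b => (hF.inv₀ fun x => (hpos x).ne').intervalIntegrable a b
  have hp : Function.Periodic (fun t => (F t)⁻¹) T := fun t => by simp only [hT t]
  have h := hp.intervalIntegral_add_zsmul_eq k y hint
  have h1 := intervalIntegral.integral_add_adjacent_intervals (hint 0 y) (hint y (y + k • T))
  simp only [zsmul_eq_mul] at h h1
  have h2 := hp.intervalIntegral_add_eq y 0
  simp only [zero_add] at h2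
  simp only [travelTime]
  rw [← h1, h, h2]

/-! ### The angle equation -/

/-- `θ` is a solution, with derivative `ρ`, of the equation that makes the surface ruled by the
lines of angle `θ` minimal, with the initial conditions of parameter `μ`. -/
structure IsAngle (μ : ℝ) (θ ρ : ℝ → ℝ) : Prop where
  zero : θ 0 = 0
  -- In coordinates the slope of a line is tan θ - v/2, so the extra 1/2 makes its derivative at 0
  -- equal to μ.
  rate_zero : ρ 0 = μ + 1 / 2
  hasDerivAt : ∀ v, HasDerivAt θ (ρ v) v
  hasDerivAt_rate : ∀ v, HasDerivAt ρ
    (Real.sin (θ v) * Real.cos (θ v) * (Real.cos (θ v) ^ 2 - 3 * ρ v)) v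
  -- This bound, locally uniform in μ, confines the trajectories to a common compact set, where
  -- `angleField` is Lipschitz.
  abs_rate_le : ∀ v, |ρ v| ≤ 2 + |μ|

/-- The vector field of the angle equation. -/
noncomputable def angleField (x : ℝ × ℝ) : ℝ × ℝ :=
  (x.2, Real.sin x.1 * Real.cos x.1 * (Real.cos x.1 ^ 2 - 3 * x.2))

theorem contDiff_angleField : ContDiff ℝ ∞ angleField := by
  unfold angleField
  have h1 : ContDiff ℝ ∞ fun x : ℝ × ℝ => x.1 := contDiff_fst
  have h2 : ContDiff ℝ ∞ fun x : ℝ × ℝ => x.2 := contDiff_snd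
  exact h2.prodMk ((h1.sin.mul h1.cos).mul ((h1.cos.pow 2).sub (contDiff_const.mul h2)))

namespace IsAngle

variable {μ ν : ℝ} {θ ρ η ψ : ℝ → ℝ}

/-- This time reversal carries estimates from v ≥ 0 to v ≤ 0. -/
theorem reverse (h : IsAngle μ θ ρ) : IsAngle μ (fun v => -θ (-v)) (fun v => ρ (-v)) where
  zero := by simp [h.zero]
  rate_zero := by simp [h.rate_zero]
  hasDerivAt v := by
    have := ((h.hasDerivAt (-v)).comp v (hasDerivAt_neg v)).fun_neg
    simpa [Function.comp_def] using this
  hasDerivAt_rate v := by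
    have := (h.hasDerivAt_rate (-v)).comp v (hasDerivAt_neg v)
    simpa [Function.comp_def] using this
  abs_rate_le v := h.abs_rate_le _

theorem hasDerivAt_prod (h : IsAngle μ θ ρ) (v : ℝ) :
    HasDerivAt (fun v => (θ v, ρ v)) (angleField (θ v, ρ v)) v :=
  (h.hasDerivAt v).prodMk (h.hasDerivAt_rate v)

theorem continuous_prod (h : IsAngle μ θ ρ) : Continuous fun v => (θ v, ρ v) :=
  continuous_iff_continuousAt.2 fun v => (h.hasDerivAt_prod v).continuousAt

theorem abs_le (h : IsAngle μ θ ρ) (v : ℝ) : |θ v| ≤ (2 + |μ|) * |v| := by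
  have := Convex.norm_image_sub_le_of_norm_hasDerivWithin_le (s := univ) (x := 0) (y := v)
    (fun x _ => (h.hasDerivAt x).hasDerivWithinAt) (fun x _ => h.abs_rate_le x) convex_univ
    (mem_univ _) (mem_univ _)
  simpa [h.zero] using this

/-- Grönwall's inequality: up to time `T` both trajectories stay in the ball, and their initial
points differ by μ - ν in the second coordinate only. -/
theorem dist_le_of_nonneg {R T : ℝ} {L : NNReal}
    (hL : LipschitzOnWith L angleField (Metric.closedBall 0 (R * T + R)))
    (hμ : 2 + |μ| ≤ R) (hν : 2 + |ν| ≤ R) (h : IsAngle μ θ ρ) (h' : IsAngle ν η ψ)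
    {v : ℝ} (hv0 : 0 ≤ v) (hvT : v ≤ T) :
    dist (θ v, ρ v) (η v, ψ v) ≤ L.toReal.exp ^ T * dist μ ν := by
  have hR : 0 ≤ R := by linarith [abs_nonneg μ]
  have hmem : ∀ {κ : ℝ} {α β : ℝ → ℝ}, 2 + |κ| ≤ R → IsAngle κ α β → ∀ t ∈ Ico 0 T,
      (α t, β t) ∈ Metric.closedBall (0 : ℝ × ℝ) (R * T + R) := by
    intro κ α β hκ hα t ht
    have h1 : |α t| ≤ R * T := (hα.abs_le t).trans <| by
      rw [abs_of_nonneg ht.1]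
      exact mul_le_mul hκ ht.2.le ht.1 hR
    have h2 : |β t| ≤ R := (hα.abs_rate_le t).trans hκ
    have h3 : 0 ≤ R * T := mul_nonneg hR (ht.1.trans ht.2.le)
    rw [mem_closedBall_zero_iff, Prod.norm_def, Real.norm_eq_abs, Real.norm_eq_abs]
    exact max_le (by linarith) (by linarith)
  have key := dist_le_of_trajectories_ODE_of_mem (v := fun _ => angleField) (a := 0) (b := T)
    (s := fun _ => Metric.closedBall 0 (R * T + R)) (K := L) (δ := dist μ ν)
    (fun t _ => hL) h.continuous_prod.continuousOn
    (fun t _ => (h.hasDerivAt_prod t).hasDerivWithinAt) (hmem hμ h)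
    h'.continuous_prod.continuousOn
    (fun t _ => (h'.hasDerivAt_prod t).hasDerivWithinAt) (hmem hν h')
    (by simp [h.zero, h'.zero, h.rate_zero, h'.rate_zero, Prod.dist_eq]) v ⟨hv0, hvT⟩
  refine key.trans ?_
  rw [mul_comm, ← Real.exp_mul, sub_zero]
  gcongr

theorem dist_le {R T : ℝ} {L : NNReal}
    (hL : LipschitzOnWith L angleField (Metric.closedBall 0 (R * T + R)))
    (hμ : 2 + |μ| ≤ R) (hν : 2 + |ν| ≤ R) (h : IsAngle μ θ ρ) (h' : IsAngle ν η ψ)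
    {v : ℝ} (hv : |v| ≤ T) :
    dist (θ v, ρ v) (η v, ψ v) ≤ L.toReal.exp ^ T * dist μ ν := by
  rcases le_total 0 v with h0 | h0
  · exact dist_le_of_nonneg hL hμ hν h h' h0 ((le_abs_self v).trans hv)
  · have := dist_le_of_nonneg hL hμ hν h.reverse h'.reverse (v := -v) (by linarith)
      ((neg_le_abs v).trans hv)
    simpa [Prod.dist_eq] using this

end IsAngle

theorem continuous_family_of_isAngle {θ ρ : ℝ → ℝ → ℝ} (h : ∀ μ, IsAngle μ (θ μ) (ρ μ)) :
    Continuous fun q : ℝ × ℝ => (θ q.1 q.2, ρ q.1 q.2) := by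
  rw [continuous_iff_continuousAt]
  rintro ⟨μ₀, v₀⟩
  set T := |v₀| + 1 with hT
  set R := 2 + (|μ₀| + 1) with hR
  obtain ⟨L, hL⟩ := ((contDiff_angleField.of_le (by norm_cast)).locallyLipschitz
    |>.locallyLipschitzOn).exists_lipschitzOnWith_of_compact
    (isCompact_closedBall (0 : ℝ × ℝ) (R * T + R))
  have hmem : Metric.ball μ₀ 1 ×ˢ Metric.ball v₀ 1 ∈ 𝓝 (μ₀, v₀) :=
    prod_mem_nhds (Metric.ball_mem_nhds _ one_pos) (Metric.ball_mem_nhds _ one_pos)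
  have hball : ∀ {x a : ℝ}, a ∈ Metric.ball x 1 → |a| ≤ |x| + 1 := by
    intro x a ha
    rw [Metric.mem_ball, Real.dist_eq] at ha
    linarith [abs_sub_abs_le_abs_sub a x]
  refine ContinuousOn.continuousAt ?_ hmem
  refine continuousOn_prod_of_continuousOn_lipschitzOnWith _
    (Real.toNNReal (L.toReal.exp ^ T)) (fun μ _ => (h μ).continuous_prod.continuousOn) ?_
  intro v hv
  refine LipschitzOnWith.of_dist_le_mul fun μ hμ ν hν => ?_
  rw [Real.coe_toNNReal _ (by positivity)]
  exact (h μ).dist_le hL (by linarith [hball hμ]) (by linarith [hball hν]) (h ν) (hball hv)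

/-! ### Families driven by a solution of an autonomous equation -/

section Driven

variable {X : Type} [NormedAddCommGroup X] [NormedSpace ℝ X] {N : X → X} {x : ℝ → ℝ → X}

/-- Since ξ' = N(ξ), the derivative is once more a smooth function of the point and of ξ. This
closure property drives the inductions on the order of differentiation. -/
theorem hasFDerivAt_driven {F : Type} [NormedAddCommGroup F] [NormedSpace ℝ F]
    {ξ : ℝ → X} (hξ : ∀ v, HasDerivAt ξ (N (ξ v)) v)
    {G : (ℝ × ℝ) × X → F} (hG : ContDiff ℝ ∞ G) (p : ℝ × ℝ) :
    HasFDerivAt (fun p : ℝ × ℝ => G (p, ξ p.2))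
      ((fderiv ℝ G (p, ξ p.2)).comp ((ContinuousLinearMap.id ℝ (ℝ × ℝ)).prod
        ((ContinuousLinearMap.snd ℝ ℝ ℝ).smulRight (N (ξ p.2))))) p := by
  have h1 : HasFDerivAt (fun p : ℝ × ℝ => ξ p.2)
      ((ContinuousLinearMap.snd ℝ ℝ ℝ).smulRight (N (ξ p.2))) p := by
    have := (hξ p.2).hasFDerivAt.comp p (hasFDerivAt_snd (𝕜 := ℝ) (E := ℝ) (F := ℝ))
    have heq : (ContinuousLinearMap.snd ℝ ℝ ℝ).smulRight (N (ξ p.2)) =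
        (ContinuousLinearMap.toSpanSingleton ℝ (N (ξ p.2))).comp
          (ContinuousLinearMap.snd ℝ ℝ ℝ) := by
      ext <;> simp
    rw [heq]
    exact this
  exact ((hG.differentiable (by simp)) _).hasFDerivAt.comp p ((hasFDerivAt_id p).prodMk h1)

theorem contDiff_driven_fderiv {F : Type} [NormedAddCommGroup F] [NormedSpace ℝ F]
    (hN : ContDiff ℝ ∞ N) {G : (ℝ × ℝ) × X → F} (hG : ContDiff ℝ ∞ G) :
    ContDiff ℝ ∞ fun q : (ℝ × ℝ) × X => (fderiv ℝ G q).comp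
      ((ContinuousLinearMap.id ℝ (ℝ × ℝ)).prod
        ((ContinuousLinearMap.snd ℝ ℝ ℝ).smulRight (N q.2))) := by
  have h1 : ContDiff ℝ ∞ (fderiv ℝ G) := hG.fderiv_right (by simp)
  refine h1.clm_comp ?_
  have h2 : ContDiff ℝ ∞ fun q : (ℝ × ℝ) × X =>
      (ContinuousLinearMap.snd ℝ ℝ ℝ).smulRight (N q.2) :=
    contDiff_const.smulRight (hN.comp contDiff_snd)
  have h3 : ∀ q : (ℝ × ℝ) × X, (ContinuousLinearMap.id ℝ (ℝ × ℝ)).prod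
        ((ContinuousLinearMap.snd ℝ ℝ ℝ).smulRight (N q.2)) =
      (ContinuousLinearMap.inl ℝ (ℝ × ℝ) X).comp (ContinuousLinearMap.id ℝ (ℝ × ℝ)) +
      (ContinuousLinearMap.inr ℝ (ℝ × ℝ) X).comp
        ((ContinuousLinearMap.snd ℝ ℝ ℝ).smulRight (N q.2)) := by
    intro q; ext <;> simp
  simp only [h3]
  exact contDiff_const.add (contDiff_const.clm_comp h2)

theorem continuous_iteratedFDeriv_driven (hN : ContDiff ℝ ∞ N)
    (hx : ∀ μ v, HasDerivAt (x μ) (N (x μ v)) v) (hc : Continuous fun q : ℝ × ℝ => x q.1 q.2)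
    -- The target space stays quantified inside the induction, because each differentiation replaces
    -- it by a space of linear maps.
    (m : ℕ) : ∀ {F : Type} [NormedAddCommGroup F] [NormedSpace ℝ F] {G : (ℝ × ℝ) × X → F},
      ContDiff ℝ ∞ G → Continuous fun q : ℝ × (ℝ × ℝ) =>
        iteratedFDeriv ℝ m (fun p : ℝ × ℝ => G (p, x q.1 p.2)) q.2 := by
  induction m with
  | zero =>
    intro F _ _ G hG
    simp only [iteratedFDeriv_zero_eq_comp, Function.comp_def]
    refine (LinearIsometryEquiv.continuous _).comp (hG.continuous.comp ?_)
    exact continuous_snd.prodMk (hc.comp (continuous_fst.prodMk (continuous_snd.comp continuous_snd)))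
  | succ m ih =>
    intro F _ _ G hG
    simp only [iteratedFDeriv_succ_eq_comp_right, Function.comp_def]
    refine (LinearIsometryEquiv.continuous _).comp ?_
    simp only [fun μ p => (hasFDerivAt_driven (hx μ) hG p).fderiv]
    exact ih (contDiff_driven_fderiv hN hG)

theorem contDiff_driven (hN : ContDiff ℝ ∞ N) {ξ : ℝ → X}
    (hξ : ∀ v, HasDerivAt ξ (N (ξ v)) v) {F : Type} [NormedAddCommGroup F] [NormedSpace ℝ F]
    {G : (ℝ × ℝ) × X → F} (hG : ContDiff ℝ ∞ G) :
    ContDiff ℝ ∞ fun p : ℝ × ℝ => G (p, ξ p.2) := by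
  rw [contDiff_infty]
  intro n
  induction n generalizing F with
  | zero =>
    refine contDiff_zero.2 (continuous_iff_continuousAt.2 fun p => ?_)
    exact (hasFDerivAt_driven hξ hG p).continuousAt
  | succ n ih =>
    rw [Nat.cast_add_one, contDiff_succ_iff_fderiv]
    refine ⟨fun p => (hasFDerivAt_driven hξ hG p).differentiableAt,
      fun h => (WithTop.natCast_ne_top n h).elim, ?_⟩
    rw [funext fun p => (hasFDerivAt_driven hξ hG p).fderiv]
    exact ih (contDiff_driven_fderiv hN hG)

end Driven

theorem IsAngle.contDiff_prod {μ : ℝ} {θ ρ : ℝ → ℝ} (h : IsAngle μ θ ρ) :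
    ContDiff ℝ ∞ fun v => (θ v, ρ v) :=
  (contDiff_driven contDiff_angleField h.hasDerivAt_prod (G := Prod.snd) contDiff_snd).comp
    (contDiff_const.prodMk contDiff_id : ContDiff ℝ ∞ fun v : ℝ => ((0 : ℝ), v))

theorem hasDerivAt_segment {E : Type*} [NormedAddCommGroup E] [NormedSpace ℝ E] (q b : E)
    (t : ℝ) : HasDerivAt (fun t : ℝ => q + t • b) b t := by
  simpa using ((hasDerivAt_id t).smul_const b).const_add q

namespace Nil3

/-! ### The Levi-Civita connection -/

/-- The differential of the connection form, up to sign. -/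
noncomputable def curvForm (U V : Nil3) : ℝ := (U 1 * V 0 - U 0 * V 1) / 2

/-- The connection form is affine in the base point, with slope `curvForm`; the rest is the product
rule. -/
theorem fderiv_metric (p U V W : Nil3) : fderiv ℝ (fun q => metric q V W) p U =
    curvForm U V * vertForm p W + vertForm p V * curvForm U W := by
  have hd : DifferentiableAt ℝ (fun q : Nil3 => metric q V W) p := by
    unfold metric vertForm; fun_prop
  have h0 : ∀ i, HasDerivAt (fun t : ℝ => (p + t • U) i) (U i) 0 := fun i => by
    simpa using ((hasDerivAt_id (0 : ℝ)).mul_const (U i)).const_add (p i)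
  have hv : ∀ V : Nil3, HasDerivAt (fun t : ℝ => vertForm (p + t • U) V) (curvForm U V) 0 :=
    fun V => ((((h0 1).mul_const (V 0)).sub ((h0 0).mul_const (V 1))).div_const 2).const_add (V 2)
  have h := ((hv V).mul (hv W)).const_add (V 0 * W 0 + V 1 * W 1)
  rw [← hd.lineDeriv_eq_fderiv, lineDeriv]
  refine h.deriv.trans ?_
  simp

theorem christoffel_eq (p U V W : Nil3) :
    christoffel p U V W = vertForm p V * curvForm U W + vertForm p U * curvForm V W := by
  simp only [christoffel, fderiv_metric, curvForm]
  ring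

/-! ### Geodesics -/

theorem isHorizontalGeodesic_line {d : Nil3} (h2 : d 2 = 0) (h1 : d 0 ^ 2 + d 1 ^ 2 = 1) :
    IsHorizontalGeodesic fun t => t • d := by
  have hd : deriv (fun t : ℝ => t • d) = fun _ => d := by
    funext t; simpa using ((hasDerivAt_id t).smul_const d).deriv
  have hv : ∀ t : ℝ, vertForm (t • d) d = 0 := fun t => by simp [vertForm, h2]; ring
  refine ⟨⟨by fun_prop, fun t => ?_, fun t W => ?_⟩, fun t => ?_⟩
  · rw [hd]; simp only [metric, hv]; linarith
  · rw [hd, christoffel_eq]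
    simp only [metric, hv]
    simp [vertForm]
  · rw [hd]; simp [metric, hv, xi]

theorem isHorizontalGeodesic_axis : IsHorizontalGeodesic axis := by
  have : axis = fun t : ℝ => t • (![0, 1, 0] : Nil3) := by
    funext t; simp [axis]
  rw [this]
  exact isHorizontalGeodesic_line (by simp) (by simp)

theorem deriv_axis (t : ℝ) : deriv axis t = ![0, 1, 0] := by
  have : axis = fun t : ℝ => t • (![0, 1, 0] : Nil3) := by
    funext t; simp [axis]
  rw [this]
  simpa using ((hasDerivAt_id t).smul_const (![0, 1, 0] : Nil3)).deriv

/-- Tangency to ξ freezes x and y, the geodesic equation tested against ξ gives z'' = 0, and unit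
speed makes z' nonzero, so the whole fibre is covered. -/
theorem isVerticalGeodesic_iff {L : Set Nil3} :
    IsVerticalGeodesic L ↔ ∃ a b, L = fibre a b := by
  constructor
  · rintro ⟨γ, ⟨hγ, hs, hg⟩, hv, rfl⟩
    have hdiff : ∀ t, HasDerivAt γ (deriv γ t) t := fun t =>
      (hγ.differentiable (by simp) t).hasDerivAt
    have hdiff2 : ∀ t, HasDerivAt (deriv γ) (deriv (deriv γ) t) t := fun t =>
      (((contDiff_infty_iff_deriv.1 hγ).2).differentiable (by simp) t).hasDerivAt
    have h01 : ∀ t, deriv γ t 0 = 0 ∧ deriv γ t 1 = 0 := fun t => by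
      obtain ⟨c, hc⟩ := hv t
      simp [hc, xi]
    have hc : ∀ i, (∀ t, deriv γ t i = 0) → ∀ t, γ t i = γ 0 i := fun i h t =>
      is_const_of_deriv_eq_zero (f := fun t => γ t i)
        (fun t => (hasDerivAt_pi.1 (hdiff t) i).differentiableAt)
        (fun t => by rw [(hasDerivAt_pi.1 (hdiff t) i).deriv, h]) t 0
    have hdd : ∀ t, deriv γ t 2 = deriv γ 0 2 := fun t =>
      is_const_of_deriv_eq_zero (f := fun t => deriv γ t 2)
        (fun t => (hasDerivAt_pi.1 (hdiff2 t) 2).differentiableAt)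
        (fun t => by
          rw [(hasDerivAt_pi.1 (hdiff2 t) 2).deriv]
          have h0 : ∀ i, (∀ t, deriv γ t i = 0) → deriv (deriv γ) t i = 0 := fun i h => by
            rw [← (hasDerivAt_pi.1 (hdiff2 t) i).deriv]
            simp [h]
          have := hg t xi
          rw [christoffel_eq] at this
          simpa [metric, vertForm, curvForm, xi, h0 0 fun t => (h01 t).1,
            h0 1 fun t => (h01 t).2] using this) t 0
    have hz : ∀ t, γ t 2 = γ 0 2 + t * deriv γ 0 2 := by
      intro t
      have hd : ∀ t, HasDerivAt (fun t => γ t 2 - t * deriv γ 0 2) 0 t := fun t => by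
        have := (hasDerivAt_pi.1 (hdiff t) 2).fun_sub
          ((hasDerivAt_id t).mul_const (deriv γ 0 2))
        rw [hdd t] at this
        simpa using this
      have := is_const_of_deriv_eq_zero (fun t => (hd t).differentiableAt)
        (fun t => (hd t).deriv) t 0
      simp only [zero_mul, sub_zero] at this
      linarith
    have hne : deriv γ 0 2 ≠ 0 := fun h => by
      have := hs 0
      simp [metric, vertForm, (h01 0).1, (h01 0).2, h] at this
    refine ⟨γ 0 0, γ 0 1, Subset.antisymm ?_ fun p hp => ?_⟩
    · rintro _ ⟨t, rfl⟩
      exact ⟨hc 0 (fun t => (h01 t).1) t, hc 1 (fun t => (h01 t).2) t⟩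
    · refine ⟨(p 2 - γ 0 2) / deriv γ 0 2, ?_⟩
      funext i
      fin_cases i
      · exact (hc 0 (fun t => (h01 t).1) _).trans hp.1.symm
      · exact (hc 1 (fun t => (h01 t).2) _).trans hp.2.symm
      · refine (hz _).trans ?_
        rw [div_mul_cancel₀ _ hne]
        simp
  · rintro ⟨a, b, rfl⟩
    have hd : deriv (fun t : ℝ => (![a, b, 0] : Nil3) + t • xi) = fun _ => xi := by
      funext t; exact (hasDerivAt_segment _ _ t).deriv
    refine ⟨fun t => ![a, b, 0] + t • xi, ⟨by fun_prop, fun t => ?_, fun t W => ?_⟩,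
      fun t => ⟨1, by rw [hd, one_smul]⟩, ?_⟩
    · rw [hd]; simp [metric, vertForm, xi]
    · rw [hd, christoffel_eq]; simp [metric, vertForm, xi, curvForm]
    · ext p
      constructor
      · intro hp
        refine ⟨p 2, ?_⟩
        funext i
        fin_cases i
        · simp [xi, hp.1]
        · simp [xi, hp.2]
        · simp [xi]
      · rintro ⟨t, rfl⟩
        simp [fibre, xi]

/-! ### Lengths -/

/-- The source of all lower bounds on distances: a quantity whose rate is at most K times the speed
changes by at most K times the length. -/
theorem ofReal_abs_sub_le_length {γ : ℝ → Nil3} {g g' : ℝ → ℝ} {K : ℝ} (hK : 0 ≤ K)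
    (hg : ∀ t, HasDerivAt g (g' t) t) (hg' : Continuous g')
    (h : ∀ t, |g' t| ≤ K * Real.sqrt (metric (γ t) (deriv γ t) (deriv γ t))) :
    ENNReal.ofReal |g 1 - g 0| ≤ ENNReal.ofReal K * length γ := by
  have h1 := intervalIntegral.integral_eq_sub_of_hasDerivAt (a := 0) (b := 1) (fun t _ => hg t)
    (hg'.intervalIntegrable _ _)
  rw [← h1, intervalIntegral.integral_of_le zero_le_one, ← Real.norm_eq_abs, ofReal_norm]
  refine (MeasureTheory.enorm_integral_le_lintegral_enorm _).trans ?_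
  rw [MeasureTheory.restrict_Ioc_eq_restrict_Icc, length,
    ← MeasureTheory.lintegral_const_mul' _ _ ENNReal.ofReal_ne_top]
  refine MeasureTheory.lintegral_mono fun t => ?_
  rw [← ENNReal.ofReal_mul hK, ← ofReal_norm, Real.norm_eq_abs]
  exact ENNReal.ofReal_le_ofReal (h t)

theorem length_le {γ : ℝ → Nil3} {C : ℝ}
    (h : ∀ t ∈ Icc (0 : ℝ) 1, Real.sqrt (metric (γ t) (deriv γ t) (deriv γ t)) ≤ C) :
    length γ ≤ ENNReal.ofReal C := by
  refine (MeasureTheory.setLIntegral_mono measurable_const fun t ht =>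
    ENNReal.ofReal_le_ofReal (h t ht)).trans ?_
  simp

/-- The coordinate y is 1-Lipschitz, and the segment of the axis between the fibres attains the
resulting bound. -/
theorem setDist_fibre {b c : ℝ} (h : b ≤ c) :
    setDist (fibre 0 b) (fibre 0 c) = ENNReal.ofReal (c - b) := by
  apply le_antisymm
  · have hder : ∀ t, deriv (fun t : ℝ => (![0, b, 0] : Nil3) + t • ![0, c - b, 0]) t =
        ![0, c - b, 0] := fun t =>
      (hasDerivAt_segment _ _ t).deriv
    refine (iInf₂_le (![0, b, 0] : Nil3) (by simp [fibre])).trans <|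
      (iInf₂_le (![0, c, 0] : Nil3) (by simp [fibre])).trans <|
      (iInf₂_le (fun t : ℝ => (![0, b, 0] : Nil3) + t • ![0, c - b, 0])
        ⟨by fun_prop, by simp, by simp⟩).trans <| length_le fun t _ => ?_
    rw [hder]
    simp [metric, vertForm, Real.sqrt_mul_self (sub_nonneg.2 h)]
  · refine le_iInf₂ fun p hp => le_iInf₂ fun q hq => le_iInf₂ fun γ hγ => ?_
    have hd : ∀ t, HasDerivAt (fun t => γ t 1) (deriv γ t 1) t := fun t =>
      hasDerivAt_pi.1 (hγ.1.differentiable one_ne_zero t).hasDerivAt 1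
    have := ofReal_abs_sub_le_length (γ := γ) zero_le_one hd
      ((continuous_apply 1).comp (hγ.1.continuous_deriv le_rfl)) fun t => by
        rw [one_mul]
        refine Real.abs_le_sqrt ?_
        unfold metric
        nlinarith [sq_nonneg (deriv γ t 0), sq_nonneg (vertForm (γ t) (deriv γ t))]
    rw [hγ.2.1, hγ.2.2, hp.2, hq.2, abs_of_nonneg (sub_nonneg.2 h)] at this
    simpa using this

/-! ### Ruled surfaces -/

/-- The surface ruled by the lines of angle `θ v` through the points of the axis. -/
noncomputable def ruled (θ : ℝ → ℝ) (p : ℝ × ℝ) : Nil3 :=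
  ![p.1 * Real.cos (θ p.2), p.2, p.1 * (Real.sin (θ p.2) - p.2 / 2 * Real.cos (θ p.2))]

/-- The differential of `ruled θ`, where `ρ` is the derivative of `θ`. -/
noncomputable def ruledDeriv (θ ρ : ℝ → ℝ) (p b : ℝ × ℝ) : Nil3 :=
  ![b.1 * Real.cos (θ p.2) - b.2 * p.1 * Real.sin (θ p.2) * ρ p.2, b.2,
    b.1 * (Real.sin (θ p.2) - p.2 / 2 * Real.cos (θ p.2)) +
      b.2 * p.1 * (Real.cos (θ p.2) * ρ p.2 + p.2 / 2 * (Real.sin (θ p.2) * ρ p.2)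
        - Real.cos (θ p.2) / 2)]

theorem hasDerivAt_ruled {θ ρ : ℝ → ℝ} (hθ : ∀ v, HasDerivAt θ (ρ v) v) {c : ℝ → ℝ × ℝ}
    {b : ℝ × ℝ} {t : ℝ} (hc : HasDerivAt c b t) :
    HasDerivAt (fun t => ruled θ (c t)) (ruledDeriv θ ρ (c t) b) t := by
  have h1 : HasDerivAt (fun t => (c t).1) b.1 t := hc.fst
  have h2 : HasDerivAt (fun t => (c t).2) b.2 t := hc.snd
  have hθ2 : HasDerivAt (fun t => θ (c t).2) (ρ (c t).2 * b.2) t := (hθ _).comp t h2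
  refine hasDerivAt_pi.2 fun i => ?_
  fin_cases i
  · refine (h1.mul hθ2.cos).congr_deriv ?_
    simp [ruledDeriv]; ring
  · simpa [ruledDeriv, ruled] using h2
  · refine (h1.mul (hθ2.sin.sub ((h2.div_const 2).mul hθ2.cos))).congr_deriv ?_
    simp [ruledDeriv]; ring

theorem fderiv_ruled {θ ρ : ℝ → ℝ} (hθ : ∀ v, HasDerivAt θ (ρ v) v) {q : ℝ × ℝ}
    (hd : DifferentiableAt ℝ (ruled θ) q) (b : ℝ × ℝ) :
    fderiv ℝ (ruled θ) q b = ruledDeriv θ ρ q b := by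
  rw [← hd.lineDeriv_eq_fderiv, lineDeriv]
  have := (hasDerivAt_ruled hθ (hasDerivAt_segment q b 0)).deriv
  simpa using this

/-- Written as a sum of squares, the first fundamental form yields at once the immersion property
and the Lipschitz bounds used for completeness. -/
theorem metric_ruledDeriv (θ ρ : ℝ → ℝ) (q b : ℝ × ℝ) :
    metric (ruled θ q) (ruledDeriv θ ρ q b) (ruledDeriv θ ρ q b) =
      (b.1 - q.1 * (Real.sin (θ q.2) * Real.cos (θ q.2)) * b.2) ^ 2 +
        (1 + (q.1 * (ρ q.2 - Real.cos (θ q.2) ^ 2)) ^ 2) * b.2 ^ 2 := by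
  simp only [metric, vertForm, ruled, ruledDeriv, Matrix.cons_val]
  linear_combination (b.1 ^ 2 + b.2 ^ 2 * q.1 ^ 2 * (ρ q.2 ^ 2 - Real.cos (θ q.2) ^ 2)) *
    Real.sin_sq_add_cos_sq (θ q.2)

end Nil3

/-! ### Smoothness, continuity in the parameter and properness of the ruled surfaces. -/

namespace Nil3

/-- `ruled θ` as a function of the point and of the values of `θ` and of its derivative. -/
noncomputable def ruledModel (q : (ℝ × ℝ) × (ℝ × ℝ)) : Nil3 :=
  ![q.1.1 * Real.cos q.2.1, q.1.2,
    q.1.1 * (Real.sin q.2.1 - q.1.2 / 2 * Real.cos q.2.1)]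

theorem contDiff_ruledModel : ContDiff ℝ ∞ ruledModel := by
  have h1 : ContDiff ℝ ∞ fun q : (ℝ × ℝ) × (ℝ × ℝ) => q.1.1 := contDiff_fst.fst
  have h2 : ContDiff ℝ ∞ fun q : (ℝ × ℝ) × (ℝ × ℝ) => q.1.2 := contDiff_fst.snd
  have h3 : ContDiff ℝ ∞ fun q : (ℝ × ℝ) × (ℝ × ℝ) => q.2.1 := contDiff_snd.fst
  refine contDiff_pi.2 fun i => ?_
  fin_cases i
  · exact h1.mul h3.cos
  · exact h2
  · exact h1.mul (h3.sin.sub ((h2.div_const 2).mul h3.cos))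

theorem isContinuousFamily_ruled {θ ρ : ℝ → ℝ → ℝ} (h : ∀ μ, IsAngle μ (θ μ) (ρ μ)) :
    IsContinuousFamily fun μ => ruled (θ μ) := fun m =>
  continuous_iteratedFDeriv_driven (x := fun μ v => (θ μ v, ρ μ v)) contDiff_angleField
    (fun μ => (h μ).hasDerivAt_prod) (continuous_family_of_isAngle h) m contDiff_ruledModel

variable {μ : ℝ} {θ ρ : ℝ → ℝ}

theorem contDiff_ruled (h : IsAngle μ θ ρ) : ContDiff ℝ ∞ (ruled θ) :=
  contDiff_driven contDiff_angleField h.hasDerivAt_prod contDiff_ruledModel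

theorem fderiv_ruled_of_isAngle (h : IsAngle μ θ ρ) (q b : ℝ × ℝ) :
    fderiv ℝ (ruled θ) q b = ruledDeriv θ ρ q b :=
  fderiv_ruled h.hasDerivAt ((contDiff_ruled h).differentiable (by simp) q) b

theorem injective_ruled (θ : ℝ → ℝ) : Function.Injective (ruled θ) := by
  rintro ⟨u, v⟩ ⟨u', v'⟩ h
  have h0 : u * Real.cos (θ v) = u' * Real.cos (θ v') := congrFun h 0
  have h1 : v = v' := congrFun h 1
  have h2 : u * (Real.sin (θ v) - v / 2 * Real.cos (θ v)) =
    u' * (Real.sin (θ v') - v' / 2 * Real.cos (θ v')) := congrFun h 2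
  subst h1
  have : u = u' := by
    linear_combination (Real.cos (θ v) + Real.sin (θ v) * v / 2) * h0 + Real.sin (θ v) * h2 +
      (u' - u) * Real.sin_sq_add_cos_sq (θ v)
  rw [this]

theorem isProperMap_of_norm_le {f : ℝ × ℝ → Nil3} (hf : Continuous f) {g : Nil3 → ℝ}
    (hg : Continuous g) (h : ∀ q, ‖q‖ ≤ g (f q)) : IsProperMap f := by
  refine isProperMap_iff_isCompact_preimage.2 ⟨hf, fun K hK => ?_⟩
  obtain ⟨R, hR⟩ := (hK.image hg).bddAbove
  refine (isCompact_closedBall (0 : ℝ × ℝ) R).of_isClosed_subset (hK.isClosed.preimage hf)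
    fun q hq => ?_
  rw [mem_closedBall_zero_iff]
  exact (h q).trans (hR (mem_image_of_mem g hq))

theorem isProperEmbedding_ruled (h : IsAngle μ θ ρ) : IsProperEmbedding (ruled θ) := by
  refine ⟨contDiff_ruled h, injective_ruled θ, fun q => ?_, ?_⟩
  · refine (injective_iff_map_eq_zero _).2 fun b hb => ?_
    have hm := metric_ruledDeriv θ ρ q b
    rw [← fderiv_ruled_of_isAngle h, hb] at hm
    have h0 : metric (ruled θ q) 0 0 = 0 := by simp [metric, vertForm]
    rw [h0] at hm
    have hA := sq_nonneg (b.1 - q.1 * (Real.sin (θ q.2) * Real.cos (θ q.2)) * b.2)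
    have hB := mul_nonneg (sq_nonneg (q.1 * (ρ q.2 - Real.cos (θ q.2) ^ 2))) (sq_nonneg b.2)
    have h2 : b.2 = 0 := by
      have : b.2 ^ 2 = 0 := by linarith [sq_nonneg b.2]
      simpa using this
    have h1 : b.1 = 0 := by
      rw [h2] at hm
      have : b.1 ^ 2 = 0 := by linear_combination -hm
      simpa using this
    exact Prod.ext h1 h2
  -- The parameter v is the coordinate y, and |u| is the Euclidean norm of (x, z + xy/2), the
  -- components along the unit direction of the ruling.
  · refine isProperMap_of_norm_le (contDiff_ruled h).continuous
      (g := fun p => Real.sqrt (p 0 ^ 2 + (p 2 + p 1 / 2 * p 0) ^ 2) + |p 1|) (by fun_prop)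
      fun q => ?_
    have hu : (ruled θ q 0) ^ 2 + (ruled θ q 2 + ruled θ q 1 / 2 * ruled θ q 0) ^ 2 = q.1 ^ 2 := by
      simp only [ruled, Matrix.cons_val]
      linear_combination q.1 ^ 2 * Real.sin_sq_add_cos_sq (θ q.2)
    change _ ≤ Real.sqrt (_ ^ 2 + (_ + _ / 2 * _) ^ 2) + |q.2|
    rw [hu, Real.sqrt_sq_eq_abs, Prod.norm_def, Real.norm_eq_abs, Real.norm_eq_abs]
    exact max_le (by linarith [abs_nonneg q.2]) (by linarith [abs_nonneg q.1])

/-! ### Minimality -/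

theorem isMinimal_ruled (h : IsAngle μ θ ρ) : IsMinimal (ruled θ) := by
  intro p n hn
  have hΦ := contDiff_ruled h
  have hd : ∀ b : ℝ × ℝ, DifferentiableAt ℝ (fun q => ruledDeriv θ ρ q b) p := fun b => by
    simp only [← fderiv_ruled_of_isAngle h]
    exact ((hΦ.fderiv_right (m := ∞) (by simp)).clm_apply contDiff_const).differentiable
      (by simp) p
  have hE : ∀ b c : ℝ × ℝ, ∀ D : Nil3,
      HasDerivAt (fun t : ℝ => ruledDeriv θ ρ (p + t • c) b) D 0 →
      fderiv ℝ (fun q => ruledDeriv θ ρ q b) p c = D := by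
    intro b c D hD
    rw [← (hd b).lineDeriv_eq_fderiv, lineDeriv]
    exact hD.deriv
  have h1 : ∀ t : ℝ, (p + t • ((1, 0) : ℝ × ℝ)) = (p.1 + t, p.2) := fun t => by ext <;> simp
  have h2 : ∀ t : ℝ, (p + t • ((0, 1) : ℝ × ℝ)) = (p.1, p.2 + t) := fun t => by ext <;> simp
  have hid : ∀ a : ℝ, HasDerivAt (fun t : ℝ => a + t) 1 0 := fun a =>
    (hasDerivAt_id (0 : ℝ)).const_add a
  have hθ : HasDerivAt (fun t => θ (p.2 + t)) (ρ p.2) 0 := by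
    simpa using HasDerivAt.comp_const_add p.2 0 (h.hasDerivAt (p.2 + 0))
  have hρ := HasDerivAt.comp_const_add p.2 0 (h.hasDerivAt_rate (p.2 + 0))
  rw [add_zero] at hρ
  have huu : fderiv ℝ (fun q => ruledDeriv θ ρ q (1, 0)) p (1, 0) = 0 := by
    refine hE _ _ ![0, 0, 0] ?_ |>.trans (by simp)
    refine hasDerivAt_pi.2 fun i => ?_
    fin_cases i <;> simpa [ruledDeriv] using hasDerivAt_const (0 : ℝ) _
  have huv : fderiv ℝ (fun q => ruledDeriv θ ρ q (0, 1)) p (1, 0) =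
      ![-(Real.sin (θ p.2) * ρ p.2), 0, Real.cos (θ p.2) * ρ p.2 +
        p.2 / 2 * (Real.sin (θ p.2) * ρ p.2) - Real.cos (θ p.2) / 2] := by
    refine hE _ _ _ ?_
    refine hasDerivAt_pi.2 fun i => ?_
    simp only [h1]
    fin_cases i
    · refine ((((hid p.1).const_mul 1).mul_const (Real.sin (θ p.2))).mul_const (ρ p.2)).const_sub
        (0 * Real.cos (θ p.2)) |>.congr_deriv ?_
      simp
    · simpa [ruledDeriv] using hasDerivAt_const (0 : ℝ) _
    · refine (((hid p.1).const_mul 1).mul_const (Real.cos (θ p.2) * ρ p.2 + p.2 / 2 *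
        (Real.sin (θ p.2) * ρ p.2) - Real.cos (θ p.2) / 2)).const_add
        (0 * (Real.sin (θ p.2) - p.2 / 2 * Real.cos (θ p.2))) |>.congr_deriv ?_
      simp
  have hvv : fderiv ℝ (fun q => ruledDeriv θ ρ q (0, 1)) p (0, 1) =
      ![-p.1 * (Real.cos (θ p.2) * ρ p.2 ^ 2 + Real.sin (θ p.2) *
          (Real.sin (θ p.2) * Real.cos (θ p.2) * (Real.cos (θ p.2) ^ 2 - 3 * ρ p.2))), 0,
        p.1 * (-(Real.sin (θ p.2) * ρ p.2 ^ 2) + Real.cos (θ p.2) *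
          (Real.sin (θ p.2) * Real.cos (θ p.2) * (Real.cos (θ p.2) ^ 2 - 3 * ρ p.2)) +
          Real.sin (θ p.2) * ρ p.2 + p.2 / 2 * (Real.cos (θ p.2) * ρ p.2 ^ 2 +
          Real.sin (θ p.2) * (Real.sin (θ p.2) * Real.cos (θ p.2) *
            (Real.cos (θ p.2) ^ 2 - 3 * ρ p.2))))] := by
    refine hE _ _ _ ?_
    refine hasDerivAt_pi.2 fun i => ?_
    simp only [h2]
    fin_cases i
    · refine ((hθ.cos.const_mul 0).sub ((hθ.sin.const_mul (1 * p.1)).mul hρ)).congr_deriv ?_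
      simp; ring
    · simpa [ruledDeriv] using hasDerivAt_const (0 : ℝ) _
    · refine ((hθ.sin.sub (((hid p.2).div_const 2).mul hθ.cos)).const_mul 0 |>.add
        ((((hθ.cos.mul hρ).add (((hid p.2).div_const 2).mul (hθ.sin.mul hρ))).sub
          (hθ.cos.div_const 2)).const_mul (1 * p.1))).congr_deriv ?_
      simp [-mul_eq_mul_left_iff]; ring
  obtain ⟨-, hn⟩ := hn
  have hn1 := hn (1, 0)
  have hn2 := hn (0, 1)
  rw [meanCurvature]
  simp only [firstForm, secondForm, fderiv_ruled_of_isAngle h, huu, huv, hvv] at hn1 hn2 ⊢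
  rw [div_eq_zero_iff]
  left
  have hS := Real.sin_sq_add_cos_sq (θ p.2)
  simp only [christoffel_eq, curvForm, metric, vertForm, ruled, ruledDeriv, Matrix.cons_val,
    Pi.zero_apply, one_mul, zero_mul, zero_add, add_zero, sub_zero, zero_sub, mul_zero] at hn1 hn2 ⊢
  generalize Real.sin (θ p.2) = S at *
  generalize Real.cos (θ p.2) = C at *
  generalize ρ p.2 = r at *
  obtain ⟨u, v⟩ := p
  -- The number m is the component of n along -sin θ E₁ + cos θ ξ. The two tangency relations
  -- determine n from m, so the curvature becomes m times a polynomial.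
  obtain ⟨m, hm⟩ : ∃ m, m = C * (n 2 + (v * n 0 - u * C * n 1) / 2) - S * n 0 := ⟨_, rfl⟩
  have e0 : n 0 = -S * m := by
    rw [hm]; linear_combination C * hn1 - n 0 * hS
  have e2 : n 2 = C * m - (v * n 0 - u * C * n 1) / 2 := by
    rw [hm]
    linear_combination S * hn1 - (n 2 + (v * n 0 - u * C * n 1) / 2) * hS
  have e1 : n 1 = -u * m * (r - C ^ 2) := by
    rw [e2, e0] at hn2
    linear_combination hn2 - u * m * r * hS
  rw [e2, e1, e0]
  clear e0 e1 e2 hm hn1 hn2 hn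
  -- Reducing the powers of the sine by S² = 1 - C² turns the remaining identity into a polynomial
  -- one.
  have hS2 : S ^ 2 = 1 - C ^ 2 := by linear_combination hS
  have h3 : S ^ 3 = S * (1 - C ^ 2) := by rw [← hS2]; ring
  have h5 : S ^ 5 = S * (1 - C ^ 2) ^ 2 := by rw [← hS2]; ring
  ring_nf
  simp only [h3, h5]
  ring

end Nil3

namespace Nil3

variable {μ : ℝ} {θ ρ : ℝ → ℝ}

/-! ### Completeness -/

theorem hasDerivAt_ruled_comp (h : IsAngle μ θ ρ) {c : ℝ → ℝ × ℝ} (hc : ContDiff ℝ 1 c) (t : ℝ) :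
    HasDerivAt (ruled θ ∘ c) (ruledDeriv θ ρ (c t) (deriv c t)) t :=
  hasDerivAt_ruled h.hasDerivAt (hc.differentiable one_ne_zero t).hasDerivAt

theorem ofReal_abs_snd_sub_le_surfaceDist (h : IsAngle μ θ ρ) (a b : ℝ × ℝ) :
    ENNReal.ofReal |b.2 - a.2| ≤ surfaceDist (ruled θ) a b := by
  refine le_iInf₂ fun c hc => ?_
  have := ofReal_abs_sub_le_length (γ := ruled θ ∘ c) (g := fun t => (c t).2)
    (g' := fun t => (deriv c t).2) zero_le_one
    (fun t => (hc.1.differentiable one_ne_zero t).hasDerivAt.snd)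
    (continuous_snd.comp (hc.1.continuous_deriv le_rfl)) fun t => by
      rw [one_mul, (hasDerivAt_ruled_comp h hc.1 t).deriv, Function.comp_apply, metric_ruledDeriv]
      refine Real.abs_le_sqrt ?_
      have := mul_nonneg (sq_nonneg ((c t).1 * (ρ (c t).2 - Real.cos (θ (c t).2) ^ 2)))
        (sq_nonneg (deriv c t).2)
      nlinarith [sq_nonneg ((deriv c t).1 -
        (c t).1 * (Real.sin (θ (c t).2) * Real.cos (θ (c t).2)) * (deriv c t).2)]
  simpa [hc.2.1, hc.2.2] using this

/-- The cross term in the metric only gives |u'| ≤ (1 + |u|) · speed. As 1 + |u| ≤ 2 √(1 + u²), the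
function arsinh(u)/2 is 1-Lipschitz. -/
theorem ofReal_abs_arsinh_sub_le_surfaceDist (h : IsAngle μ θ ρ) (a b : ℝ × ℝ) :
    ENNReal.ofReal |Real.arsinh b.1 / 2 - Real.arsinh a.1 / 2| ≤ surfaceDist (ruled θ) a b := by
  refine le_iInf₂ fun c hc => ?_
  have hpos : ∀ x : ℝ, 0 < Real.sqrt (1 + x ^ 2) := fun x => Real.sqrt_pos.2 (by positivity)
  have := ofReal_abs_sub_le_length (γ := ruled θ ∘ c) (g := fun t => Real.arsinh (c t).1 / 2)
    (g' := fun t => (Real.sqrt (1 + (c t).1 ^ 2))⁻¹ * (deriv c t).1 / 2) zero_le_one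
    (fun t => by
      have h1 : HasDerivAt (fun t => (c t).1) (deriv c t).1 t :=
        (hc.1.differentiable one_ne_zero t).hasDerivAt.fst
      exact h1.arsinh.div_const 2)
    (by
      have h1 : Continuous fun t => (c t).1 := hc.1.continuous.fst
      have h2 : Continuous fun t => (deriv c t).1 := (hc.1.continuous_deriv le_rfl).fst
      exact (((by fun_prop : Continuous fun t => Real.sqrt (1 + (c t).1 ^ 2)).inv₀
        fun t => (hpos _).ne').mul h2).div_const 2) fun t => by
      rw [one_mul, (hasDerivAt_ruled_comp h hc.1 t).deriv, Function.comp_apply, metric_ruledDeriv]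
      set u := (c t).1
      set x := (deriv c t).1
      set y := (deriv c t).2
      set k := Real.sin (θ (c t).2) * Real.cos (θ (c t).2) with hk
      set Q := (x - u * k * y) ^ 2 + (1 + (u * (ρ (c t).2 - Real.cos (θ (c t).2) ^ 2)) ^ 2) * y ^ 2
      have hk1 : |k| ≤ 1 := by
        rw [hk, abs_mul]
        exact mul_le_one₀ (Real.abs_sin_le_one _) (abs_nonneg _) (Real.abs_cos_le_one _)
      have hm := mul_nonneg (sq_nonneg (u * (ρ (c t).2 - Real.cos (θ (c t).2) ^ 2))) (sq_nonneg y)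
      have hx : |x - u * k * y| ≤ Real.sqrt Q :=
        Real.abs_le_sqrt (by simp only [Q]; nlinarith [sq_nonneg y])
      have hy : |y| ≤ Real.sqrt Q :=
        Real.abs_le_sqrt (by simp only [Q]; nlinarith [sq_nonneg (x - u * k * y)])
      have hxs : |x| ≤ (1 + |u|) * Real.sqrt Q := by
        have h1 : |u * k * y| ≤ |u| * Real.sqrt Q := by
          rw [abs_mul, abs_mul]
          exact mul_le_mul (mul_le_of_le_one_right (abs_nonneg u) hk1) hy (abs_nonneg _)
            (abs_nonneg _)
        have h2 : |x| ≤ |x - u * k * y| + |u * k * y| := by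
          simpa using abs_add_le (x - u * k * y) (u * k * y)
        linarith
      have hu : 1 + |u| ≤ 2 * Real.sqrt (1 + u ^ 2) := by
        have h1 : |u| ≤ Real.sqrt (1 + u ^ 2) := Real.abs_le_sqrt (by linarith)
        have h2 : 1 ≤ Real.sqrt (1 + u ^ 2) := Real.one_le_sqrt.2 (by linarith [sq_nonneg u])
        linarith
      rw [abs_div, abs_mul, abs_inv, abs_of_pos (hpos u), abs_two, div_le_iff₀ two_pos,
        inv_mul_le_iff₀ (hpos u)]
      nlinarith [mul_le_mul_of_nonneg_right hu (Real.sqrt_nonneg Q)]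
  simpa [hc.2.1, hc.2.2] using this

/-- The parameter segment from a to b is the test curve. The two squares in `metric_ruledDeriv` are
at most ((1 + R)β)² and ((1 + R(3 + |μ|))β)² with β = ‖b - a‖; the constant adds the two roots. -/
theorem surfaceDist_le (h : IsAngle μ θ ρ) {R : ℝ} {a b : ℝ × ℝ} (ha : |a.1| ≤ R)
    (hb : |b.1| ≤ R) :
    surfaceDist (ruled θ) a b ≤ ENNReal.ofReal ((2 + R + R * (3 + |μ|)) * ‖b - a‖) := by
  have hR : 0 ≤ R := (abs_nonneg _).trans ha
  have hc : ContDiff ℝ 1 fun t : ℝ => a + t • (b - a) := by fun_prop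
  refine (iInf₂_le (fun t : ℝ => a + t • (b - a)) ⟨hc, by simp, by simp⟩).trans <|
    length_le fun t ht => ?_
  rw [(hasDerivAt_ruled_comp h hc t).deriv, (hasDerivAt_segment a (b - a) t).deriv,
    Function.comp_apply, metric_ruledDeriv]
  set β := ‖b - a‖ with hβ
  have hx : |(b - a).1| ≤ β := norm_fst_le (b - a)
  have hy : |(b - a).2| ≤ β := norm_snd_le (b - a)
  set q := a + t • (b - a) with hq
  have hu : |q.1| ≤ R := by
    have h1 : q.1 = (1 - t) * a.1 + t * b.1 := by simp [hq]; ring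
    rw [abs_le] at ha hb ⊢
    rw [h1]
    constructor <;> nlinarith [ht.1, ht.2]
  set k := Real.sin (θ q.2) * Real.cos (θ q.2) with hk
  have hk1 : |k| ≤ 1 := by
    rw [hk, abs_mul]
    exact mul_le_one₀ (Real.abs_sin_le_one _) (abs_nonneg _) (Real.abs_cos_le_one _)
  have hρ : |ρ q.2 - Real.cos (θ q.2) ^ 2| ≤ 3 + |μ| := by
    refine (abs_sub _ _).trans ?_
    rw [abs_of_nonneg (sq_nonneg (Real.cos (θ q.2)))]
    linarith [h.abs_rate_le q.2, Real.cos_sq_le_one (θ q.2)]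
  have h1 : |(b - a).1 - q.1 * k * (b - a).2| ≤ (1 + R) * β := by
    refine (abs_sub _ _).trans ?_
    rw [abs_mul, abs_mul]
    have := mul_le_mul (mul_le_mul hu hk1 (abs_nonneg _) hR) hy (abs_nonneg _) (by linarith)
    linarith
  have h2 : |q.1 * (ρ q.2 - Real.cos (θ q.2) ^ 2)| ≤ R * (3 + |μ|) := by
    rw [abs_mul]
    exact mul_le_mul hu hρ (abs_nonneg _) hR
  refine Real.sqrt_le_iff.2 ⟨by positivity, ?_⟩
  have h3 := sq_le_sq' (abs_le.1 h1).1 (abs_le.1 h1).2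
  have h4 := sq_le_sq' (abs_le.1 h2).1 (abs_le.1 h2).2
  have h5 := sq_le_sq' (abs_le.1 hy).1 (abs_le.1 hy).2
  have hM : 0 ≤ R * (3 + |μ|) := by positivity
  have h6 : (1 + (q.1 * (ρ q.2 - Real.cos (θ q.2) ^ 2)) ^ 2) * (b - a).2 ^ 2 ≤
      (1 + R * (3 + |μ|)) ^ 2 * β ^ 2 :=
    mul_le_mul (by nlinarith) h5 (sq_nonneg _) (sq_nonneg _)
  have h7 : 0 ≤ (1 + R) * β * ((1 + R * (3 + |μ|)) * β) := by positivity
  nlinarith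

theorem exists_tendsto_of_abs_sub_le {φ : ℝ × ℝ → Nil3} {g : ℝ × ℝ → ℝ}
    (hg : ∀ a b, ENNReal.ofReal |g b - g a| ≤ surfaceDist φ a b) {s : ℕ → ℝ × ℝ}
    (hs : ∀ ε : ℝ≥0∞, 0 < ε → ∃ N, ∀ m ≥ N, ∀ n ≥ N, surfaceDist φ (s m) (s n) < ε) :
    ∃ l, Tendsto (fun n => g (s n)) atTop (𝓝 l) := by
  refine cauchySeq_tendsto_of_complete (Metric.cauchySeq_iff.2 fun ε hε => ?_)
  obtain ⟨N, hN⟩ := hs (ENNReal.ofReal ε) (ENNReal.ofReal_pos.2 hε)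
  exact ⟨N, fun m hm n hn =>
    (ENNReal.ofReal_lt_ofReal_iff hε).1 ((hg (s n) (s m)).trans_lt (hN n hn m hm))⟩

/-- Both 1-Lipschitz functions converge along a Cauchy sequence, hence so do u and v; the upper
bound on a strip |u| ≤ R then gives intrinsic convergence. -/
theorem isCompleteSurface_ruled (h : IsAngle μ θ ρ) : IsCompleteSurface (ruled θ) := by
  intro s hs
  obtain ⟨v, hv⟩ := exists_tendsto_of_abs_sub_le (ofReal_abs_snd_sub_le_surfaceDist h) hs
  obtain ⟨l, hl⟩ := exists_tendsto_of_abs_sub_le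
    (g := fun p => Real.arsinh p.1 / 2) (ofReal_abs_arsinh_sub_le_surfaceDist h) hs
  have hu : Tendsto (fun n => (s n).1) atTop (𝓝 (Real.sinh (2 * l))) := by
    have := (Real.continuous_sinh.tendsto (2 * l)).comp (hl.const_mul 2)
    refine this.congr fun n => ?_
    rw [Function.comp_apply, mul_div_cancel₀ _ two_ne_zero, Real.sinh_arsinh]
  set a : ℝ × ℝ := (Real.sinh (2 * l), v) with ha
  have hsa : Tendsto s atTop (𝓝 a) := hu.prodMk_nhds hv
  refine ⟨a, ?_⟩
  have hd : Tendsto (fun n => (2 + (|a.1| + 1) + (|a.1| + 1) * (3 + |μ|)) * ‖a - s n‖) atTop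
      (𝓝 0) := by
    have := ((tendsto_const_nhds (x := a)).sub hsa).norm.const_mul
      (2 + (|a.1| + 1) + (|a.1| + 1) * (3 + |μ|))
    simpa using this
  have hd' := ENNReal.tendsto_ofReal hd
  rw [ENNReal.ofReal_zero] at hd'
  refine tendsto_of_tendsto_of_tendsto_of_le_of_le' tendsto_const_nhds hd'
    (Eventually.of_forall fun _ => zero_le) ?_
  have : ∀ᶠ n in atTop, |(s n).1| < |a.1| + 1 :=
    hu.abs.eventually_lt_const (lt_add_one |a.1|)
  filter_upwards [this] with n hn
  exact surfaceDist_le h hn.le (by linarith)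

/-! ### Lines and fibres in a ruled surface -/

theorem ruled_direction (θ : ℝ → ℝ) (v : ℝ) :
    Real.cos (θ v) • crossXi (axis v) (deriv axis v) + Real.sin (θ v) • xi =
      ![Real.cos (θ v), 0, Real.sin (θ v) - v / 2 * Real.cos (θ v)] := by
  rw [deriv_axis]
  ext i
  fin_cases i <;> simp [crossXi, E1, E2, axis, xi]
  ring

theorem range_ruled (θ : ℝ → ℝ) : range (ruled θ) = ⋃ v, straightLine (axis v)
    (Real.cos (θ v) • crossXi (axis v) (deriv axis v) + Real.sin (θ v) • xi) := by
  ext p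
  simp only [mem_range, mem_iUnion, straightLine, ruled_direction, Prod.exists]
  rw [exists_comm]
  refine exists_congr fun v => exists_congr fun u => Eq.congr_left ?_
  ext i
  fin_cases i <;> simp [ruled, axis]

theorem isFoliatedByOrthogonalLines_ruled (h : ContDiff ℝ ∞ θ) :
    IsFoliatedByOrthogonalLines (range (ruled θ)) axis := by
  refine ⟨fun v => Real.cos (θ v) • crossXi (axis v) (deriv axis v) + Real.sin (θ v) • xi,
    ?_, fun v => ⟨fun h0 => ?_, ?_⟩, fun v w hvw => ?_, range_ruled θ⟩
  · simp only [ruled_direction]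
    refine contDiff_pi.2 fun i => ?_
    fin_cases i
    · exact h.cos
    · exact contDiff_const
    · exact h.sin.sub ((contDiff_id.div_const 2).mul h.cos)
  · simp only [ruled_direction] at h0
    have h1 : Real.cos (θ v) = 0 := congrFun h0 0
    have h2 : Real.sin (θ v) - v / 2 * Real.cos (θ v) = 0 := congrFun h0 2
    have := Real.sin_sq_add_cos_sq (θ v)
    rw [h1, mul_zero, sub_zero] at h2
    simp [h1, h2] at this
  · simp only [ruled_direction]
    rw [deriv_axis]
    simp [metric, vertForm, axis]
  · simp only [ruled_direction]
    refine Set.disjoint_left.2 ?_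
    rintro _ ⟨s, rfl⟩ ⟨t, ht⟩
    exact hvw (by simpa [axis] using (congrFun ht 1).symm)

theorem containsOrthogonalHorizontalGeodesic_ruled (h : θ 0 = 0) :
    ContainsOrthogonalHorizontalGeodesic (range (ruled θ)) axis := by
  refine ⟨fun t => t • ![1, 0, 0], isHorizontalGeodesic_line (by simp) (by simp), ?_, 0, 0, ?_, ?_⟩
  · rintro _ ⟨t, rfl⟩
    exact ⟨(t, 0), by simp [ruled, h]⟩
  · ext i
    fin_cases i <;> simp [axis]
  · have : deriv (fun t : ℝ => t • (![1, 0, 0] : Nil3)) 0 = ![1, 0, 0] := by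
      simpa using (hasDerivAt_segment (0 : Nil3) ![1, 0, 0] 0).deriv
    rw [this, deriv_axis]
    simp [metric, vertForm, axis]

theorem ruled_div_cos {v : ℝ} (hv : Real.cos (θ v) ≠ 0) (u : ℝ) :
    ruled θ (u / Real.cos (θ v), v) = ![u, v, u * (Real.tan (θ v) - v / 2)] := by
  ext i
  fin_cases i
  · simp [ruled, hv]
  · simp [ruled]
  · simp only [ruled, Real.tan_eq_sin_div_cos, Fin.reduceFinMk, Matrix.cons_val]
    field_simp

theorem hasInitialRotation_ruled (h : IsAngle μ θ ρ) :
    HasInitialRotation (range (ruled θ)) μ := by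
  have hcos : ∀ᶠ v in 𝓝 (0 : ℝ), Real.cos (θ v) ≠ 0 :=
    (h.hasDerivAt 0).cos.continuousAt.eventually_ne (by simp [h.zero])
  obtain ⟨δ, hδ, hball⟩ := Metric.eventually_nhds_iff.1 hcos
  refine ⟨δ, fun v => Real.tan (θ v) - v / 2, hδ, by simp [h.zero], ?_, fun u v hv => ?_⟩
  · have h1 : HasDerivAt (fun v => Real.tan (θ v)) (1 / Real.cos (θ 0) ^ 2 * ρ 0) 0 :=
      (Real.hasDerivAt_tan (by simp [h.zero])).comp 0 (h.hasDerivAt 0)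
    refine (h1.sub ((hasDerivAt_id (0 : ℝ)).div_const 2)).congr_deriv ?_
    simp [h.zero, h.rate_zero]
  · exact ⟨_, ruled_div_cos (hball (by simpa using hv)) u⟩

theorem isEntireGraph_ruled (h : ContDiff ℝ ∞ θ) (hcos : ∀ v, Real.cos (θ v) ≠ 0) :
    IsEntireGraph (range (ruled θ)) := by
  refine ⟨fun q => q.1 * (Real.sin (θ q.2) / Real.cos (θ q.2) - q.2 / 2), ?_, ?_⟩
  · have h2 : ContDiff ℝ ∞ fun q : ℝ × ℝ => θ q.2 := h.comp contDiff_snd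
    exact contDiff_fst.mul ((h2.sin.div h2.cos fun q => hcos _).sub (contDiff_snd.div_const 2))
  · simp only [← Real.tan_eq_sin_div_cos]
    ext p
    constructor
    · rintro ⟨q, rfl⟩
      refine ⟨(q.1 * Real.cos (θ q.2), q.2), ?_⟩
      simp only
      rw [← ruled_div_cos (hcos q.2), mul_div_cancel_right₀ _ (hcos q.2)]
    · rintro ⟨q, rfl⟩
      exact ⟨_, ruled_div_cos (hcos q.2) q.1⟩

/-- Over (a, b) the parameter satisfies u cos θ(b) = a. Unless the cosine vanishes, u is unique and
the surface meets the fibre only once. -/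
theorem fibre_subset_range_ruled_iff {a b : ℝ} :
    fibre a b ⊆ range (ruled θ) ↔ a = 0 ∧ Real.cos (θ b) = 0 := by
  constructor
  · intro h
    have hz : ∀ z : ℝ, ∃ u : ℝ, u * Real.cos (θ b) = a ∧
        u * (Real.sin (θ b) - b / 2 * Real.cos (θ b)) = z := fun z => by
      obtain ⟨⟨u, v⟩, hq⟩ := h (show (![a, b, z] : Nil3) ∈ fibre a b by simp [fibre])
      have h1 : v = b := congrFun hq 1
      subst h1
      exact ⟨u, congrFun hq 0, congrFun hq 2⟩
    obtain ⟨u, hu, hu0⟩ := hz 0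
    obtain ⟨w, hw, hw1⟩ := hz 1
    have hc : Real.cos (θ b) = 0 := by
      by_contra hc
      have : u = w := mul_right_cancel₀ hc (hu.trans hw.symm)
      rw [this] at hu0
      linarith
    exact ⟨by rw [← hu, hc, mul_zero], hc⟩
  · rintro ⟨rfl, hc⟩ p ⟨h0, h1⟩
    have hs := Real.sin_sq_add_cos_sq (θ b)
    refine ⟨(p 2 * Real.sin (θ b), b), ?_⟩
    ext i
    fin_cases i
    · simp [ruled, hc, h0]
    · simp [ruled, h1]
    · simp only [ruled, hc, Fin.reduceFinMk, Matrix.cons_val] at hs ⊢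
      linear_combination p 2 * hs

/-! ### Helicoid type -/

/-- The angle `θ`, with derivative `ρ`, rotates in the direction `ε` and makes a half turn in the
time `D`. -/
structure IsHelicoidAngle (θ ρ : ℝ → ℝ) (ε D : ℝ) : Prop where
  rate_pos : ∀ v, 0 < ε * ρ v
  surjective : Function.Surjective θ
  cos_eq_zero_iff : ∀ v, Real.cos (θ v) = 0 ↔ ∃ k : ℤ, v = ((k : ℝ) + 1 / 2) * D
  reflect : ∀ b, Real.cos (θ b) = 0 → ∀ v, θ (2 * b - v) = 2 * θ b - θ v

variable {ε D : ℝ}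

/-- Reflection of θ about an odd multiple of π/2 changes the sign of the cosine and keeps the sine,
which is the effect of the axial symmetry on the rulings. -/
theorem IsHelicoidAngle.axialSymmetry_ruled (h : IsHelicoidAngle θ ρ ε D) {b : ℝ}
    (hb : Real.cos (θ b) = 0) (q : ℝ × ℝ) :
    axialSymmetry 0 b (ruled θ q) = ruled θ (q.1, 2 * b - q.2) := by
  have hc : Real.cos (θ (2 * b - q.2)) = -Real.cos (θ q.2) := by
    rw [h.reflect b hb, Real.cos_sub, Real.cos_two_mul, Real.sin_two_mul, hb]; ring
  have hsin : Real.sin (θ (2 * b - q.2)) = Real.sin (θ q.2) := by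
    rw [h.reflect b hb, Real.sin_sub, Real.cos_two_mul, Real.sin_two_mul, hb]; ring
  ext i
  fin_cases i
  · simp [axialSymmetry, ruled, hc]
  · simp [axialSymmetry, ruled]
  · simp [axialSymmetry, ruled, hc, hsin]; ring

theorem IsHelicoidAngle.isHorizontalHelicoid (h : IsHelicoidAngle θ ρ ε D)
    (hθ : IsAngle μ θ ρ) : IsHorizontalHelicoid (range (ruled θ)) axis ε := by
  refine ⟨⟨θ, hθ.contDiff_prod.fst, fun v => ?_, h.surjective, range_ruled θ⟩, fun a b hab => ?_⟩
  · rw [(hθ.hasDerivAt v).deriv]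
    exact h.rate_pos v
  · obtain ⟨rfl, hb⟩ := fibre_subset_range_ruled_iff.1 hab
    ext p
    constructor
    · rintro ⟨_, ⟨q, rfl⟩, rfl⟩
      exact ⟨_, (h.axialSymmetry_ruled hb q).symm⟩
    · rintro ⟨q, rfl⟩
      refine ⟨_, mem_range_self (q.1, 2 * b - q.2), ?_⟩
      rw [h.axialSymmetry_ruled hb, sub_sub_cancel]

theorem IsHelicoidAngle.verticalGeodesics (h : IsHelicoidAngle θ ρ ε D) :
    {L : Set Nil3 | IsVerticalGeodesic L ∧ L ⊆ range (ruled θ)} =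
      range fun k : ℤ => fibre 0 (((k : ℝ) + 1 / 2) * D) := by
  ext L
  simp only [mem_ofPred_eq, isVerticalGeodesic_iff, mem_range]
  constructor
  · rintro ⟨⟨a, b, rfl⟩, hL⟩
    obtain ⟨rfl, hb⟩ := fibre_subset_range_ruled_iff.1 hL
    obtain ⟨k, rfl⟩ := (h.cos_eq_zero_iff b).1 hb
    exact ⟨k, rfl⟩
  · rintro ⟨k, rfl⟩
    exact ⟨⟨_, _, rfl⟩, fibre_subset_range_ruled_iff.2
      ⟨rfl, (h.cos_eq_zero_iff _).2 ⟨k, rfl⟩⟩⟩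

theorem setDist_successive_fibre (hD : 0 ≤ D) (k : ℤ) :
    setDist (fibre 0 (((k : ℝ) + 1 / 2) * D)) (fibre 0 (((k : ℝ) + 3 / 2) * D)) =
      ENNReal.ofReal D := by
  rw [setDist_fibre (mul_le_mul_of_nonneg_right (by linarith) hD)]
  congr 1
  ring

end Nil3

/-! ### The half turn time -/

/-- The speed of rotation of the lines as a function of the first integral `K` and of the square
`c` of the cosine (`δ = 0`) or of the sine (`δ = 1`) of their angle. -/
noncomputable def turnRate (δ K c : ℝ) : ℝ := K + c + Real.sqrt ((K + δ) * (K + c))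

theorem le_turnRate {δ K c : ℝ} (hc : 0 ≤ c) : K ≤ turnRate δ K c := by
  have := Real.sqrt_nonneg ((K + δ) * (K + c))
  unfold turnRate
  linarith

theorem turnRate_pos {δ K c : ℝ} (hK : 0 < K) (hc : 0 ≤ c) : 0 < turnRate δ K c :=
  hK.trans_le (le_turnRate hc)

theorem turnRate_le {δ K c : ℝ} (hK : 0 < K) (hδ : δ ≤ 1) (hc : 0 ≤ c) (hc1 : c ≤ 1) :
    turnRate δ K c ≤ 2 * K + 2 := by
  have : Real.sqrt ((K + δ) * (K + c)) ≤ K + 1 := by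
    refine Real.sqrt_le_iff.2 ⟨by linarith, ?_⟩
    rw [sq]
    exact mul_le_mul (by linarith) (by linarith) (by linarith) (by linarith)
  unfold turnRate
  linarith

theorem turnRate_lt {δ K L c : ℝ} (hK : 0 < K) (hKL : K < L) (hδ : 0 ≤ δ) (hc : 0 ≤ c) :
    turnRate δ K c < turnRate δ L c := by
  have : Real.sqrt ((K + δ) * (K + c)) ≤ Real.sqrt ((L + δ) * (L + c)) :=
    Real.sqrt_le_sqrt (mul_le_mul (by linarith) (by linarith) (by linarith) (by linarith))
  unfold turnRate
  linarith

theorem continuous_turnRate (δ : ℝ) : Continuous fun q : ℝ × ℝ => turnRate δ q.1 q.2 := by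
  unfold turnRate
  fun_prop

theorem hasDerivAt_turnRate {δ K : ℝ} {c : ℝ → ℝ} {c' v : ℝ} (hc : HasDerivAt c c' v)
    (h : (K + δ) * (K + c v) ≠ 0) : HasDerivAt (fun v => turnRate δ K (c v))
      (c' * (1 + (K + δ) / (2 * Real.sqrt ((K + δ) * (K + c v))))) v := by
  have h1 := hc.const_add K
  refine (h1.add ((h1.const_mul (K + δ)).sqrt h)).congr_deriv ?_
  ring

/-- The time in which the lines make a half turn. -/
noncomputable def halfTurn (δ K : ℝ) : ℝ :=
  travelTime (fun x => turnRate δ K (Real.sin x ^ 2)) Real.pi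

/-- A shift by π/2 over a full period; it lets both directions of rotation share the integral with
sin². -/
theorem halfTurn_eq_cos (δ K : ℝ) :
    halfTurn δ K = travelTime (fun x => turnRate δ K (Real.cos x ^ 2)) Real.pi := by
  have hp : Function.Periodic (fun x => (turnRate δ K (Real.cos x ^ 2))⁻¹) Real.pi := fun x => by
    simp [Real.cos_add_pi]
  have h := intervalIntegral.integral_comp_sub_right (a := 0) (b := Real.pi)
    (fun x => (turnRate δ K (Real.cos x ^ 2))⁻¹) (Real.pi / 2)
  simp only [Real.cos_sub_pi_div_two] at h
  have h2 := hp.intervalIntegral_add_eq (0 - Real.pi / 2) 0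
  simp only [halfTurn, travelTime]
  rw [zero_add] at h2
  rw [h, ← h2]
  congr 1
  ring

section

variable {δ : ℝ}

theorem intervalIntegrable_inv_turnRate {K : ℝ} (hK : 0 < K) (a b : ℝ) : IntervalIntegrable
    (fun x => (turnRate δ K (Real.sin x ^ 2))⁻¹) MeasureTheory.volume a b := by
  refine Continuous.intervalIntegrable (Continuous.inv₀ ?_ fun x =>
    (turnRate_pos hK (sq_nonneg _)).ne') a b
  unfold turnRate
  fun_prop

theorem strictAntiOn_halfTurn (hδ : 0 ≤ δ) : StrictAntiOn (halfTurn δ) (Ioi 0) := by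
  intro K hK L hL hKL
  have hcont : ∀ M : ℝ, 0 < M →
      ContinuousOn (fun x => (turnRate δ M (Real.sin x ^ 2))⁻¹) (Icc 0 Real.pi) := fun M hM => by
    refine (Continuous.inv₀ ?_ fun x => (turnRate_pos hM (sq_nonneg _)).ne').continuousOn
    unfold turnRate
    fun_prop
  have hlt : ∀ x : ℝ, (turnRate δ L (Real.sin x ^ 2))⁻¹ < (turnRate δ K (Real.sin x ^ 2))⁻¹ :=
    fun x => inv_strictAnti₀ (turnRate_pos hK (sq_nonneg _))
      (turnRate_lt hK hKL hδ (sq_nonneg _))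
  exact intervalIntegral.integral_lt_integral_of_continuousOn_of_le_of_exists_lt Real.pi_pos
    (hcont L hL) (hcont K hK) (fun x _ => (hlt x).le) ⟨0, ⟨le_rfl, Real.pi_pos.le⟩, hlt 0⟩

theorem continuousOn_halfTurn : ContinuousOn (halfTurn δ) (Ioi 0) := by
  rw [continuousOn_iff_continuous_domRestrict]
  refine intervalIntegral.continuous_parametric_intervalIntegral_of_continuous'
    (f := fun (K : Ioi (0 : ℝ)) x => (turnRate δ K (Real.sin x ^ 2))⁻¹) ?_ 0 Real.pi
  refine Continuous.inv₀ ?_ fun q => (turnRate_pos q.1.2 (sq_nonneg _)).ne'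
  exact (continuous_turnRate δ).comp ((continuous_subtype_val.comp continuous_fst).prodMk
    ((Real.continuous_sin.comp continuous_snd).pow 2))

theorem halfTurn_pos {K : ℝ} (hK : 0 < K) : 0 < halfTurn δ K := by
  have hc : Continuous fun x => turnRate δ K (Real.sin x ^ 2) := by
    unfold turnRate
    fun_prop
  have := strictMono_travelTime hc (fun x => turnRate_pos hK (sq_nonneg _)) Real.pi_pos
  rwa [travelTime_zero] at this

theorem tendsto_halfTurn_atTop : Tendsto (halfTurn δ) atTop (𝓝 0) := by
  have h : Tendsto (fun K : ℝ => Real.pi * K⁻¹) atTop (𝓝 0) := by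
    simpa using tendsto_inv_atTop_zero.const_mul Real.pi
  refine tendsto_of_tendsto_of_tendsto_of_le_of_le' tendsto_const_nhds h ?_ ?_
  · filter_upwards [eventually_gt_atTop 0] with K hK using (halfTurn_pos hK).le
  · filter_upwards [eventually_gt_atTop 0] with K hK
    have := intervalIntegral.integral_mono_on Real.pi_pos.le
      (intervalIntegrable_inv_turnRate (δ := δ) hK 0 Real.pi)
      (intervalIntegrable_const (c := K⁻¹)) fun x _ =>
        inv_anti₀ hK (le_turnRate (sq_nonneg (Real.sin x)))
    simpa [halfTurn, travelTime] using this

/-- Near x = 0, with a = √K, one has K + sin² x ≤ (x + a)², so the speed is at most 4(x + a).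
Integrating 1/(4(x + a)) over [0, 1] produces the logarithm; the rest of the integral is
nonnegative. -/
theorem log_le_halfTurn (hδ1 : δ ≤ 1) {K : ℝ} (hK : 0 < K) (hK1 : K ≤ 1) :
    Real.log (Real.sqrt K)⁻¹ / 4 ≤ halfTurn δ K := by
  set a := Real.sqrt K with ha
  have ha0 : 0 < a := Real.sqrt_pos.2 hK
  have ha2 : a ^ 2 = K := Real.sq_sqrt hK.le
  have ha1 : a ≤ 1 := (Real.sqrt_le_sqrt hK1).trans_eq Real.sqrt_one
  have hle : ∀ x ∈ Icc (0 : ℝ) 1, (x + a)⁻¹ / 4 ≤ (turnRate δ K (Real.sin x ^ 2))⁻¹ := by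
    intro x hx
    have hx0 : 0 ≤ x := hx.1
    have hx1 : x ≤ 1 := hx.2
    have hsin : Real.sin x ^ 2 ≤ x ^ 2 :=
      pow_le_pow_left₀ (Real.sin_nonneg_of_nonneg_of_le_pi hx.1 (hx.2.trans (by
        linarith [Real.pi_gt_three]))) (Real.sin_le hx.1) 2
    have h1 : K + Real.sin x ^ 2 ≤ (x + a) ^ 2 := by nlinarith
    have h2 : Real.sqrt ((K + δ) * (K + Real.sin x ^ 2)) ≤ 2 * (x + a) := by
      refine Real.sqrt_le_iff.2 ⟨by linarith, ?_⟩
      have : (K + δ) * (K + Real.sin x ^ 2) ≤ 2 * (x + a) ^ 2 :=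
        mul_le_mul (by linarith) h1 (by positivity) two_pos.le
      nlinarith
    rw [div_eq_mul_inv, ← mul_inv]
    refine inv_anti₀ (turnRate_pos hK (sq_nonneg _)) ?_
    unfold turnRate
    nlinarith
  have hi : ∀ x ∈ Icc (0 : ℝ) 1, x + a ≠ 0 := fun x hx => by linarith [hx.1] |> ne_of_gt
  have hI := intervalIntegral.integral_mono_on zero_le_one
    (ContinuousOn.intervalIntegrable (by
      rw [uIcc_of_le zero_le_one]
      exact ((by fun_prop : Continuous fun x : ℝ => x + a).continuousOn.inv₀ hi).div_const 4))
    (intervalIntegrable_inv_turnRate (δ := δ) hK 0 1) hle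
  have hJ := intervalIntegral.integral_add_adjacent_intervals
    (intervalIntegrable_inv_turnRate (δ := δ) hK 0 1)
    (intervalIntegrable_inv_turnRate (δ := δ) hK 1 Real.pi)
  have hP : 0 ≤ ∫ x in (1 : ℝ)..Real.pi, (turnRate δ K (Real.sin x ^ 2))⁻¹ :=
    intervalIntegral.integral_nonneg (by linarith [Real.pi_gt_three]) fun x _ =>
      (inv_pos.2 (turnRate_pos hK (sq_nonneg _))).le
  have hL : Real.log a⁻¹ / 4 ≤ ∫ x in (0 : ℝ)..1, (x + a)⁻¹ / 4 := by
    rw [intervalIntegral.integral_div,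
      intervalIntegral.integral_comp_add_right (fun x => x⁻¹) a, zero_add,
      integral_inv_of_pos ha0 (by linarith)]
    gcongr
    rw [div_eq_mul_inv]
    exact le_mul_of_one_le_left (inv_pos.2 ha0).le (by linarith)
  simp only [halfTurn, travelTime]
  linarith

theorem tendsto_halfTurn_zero (hδ1 : δ ≤ 1) : Tendsto (halfTurn δ) (𝓝[>] 0) atTop := by
  have h1 : Tendsto Real.sqrt (𝓝[>] 0) (𝓝[>] 0) := by
    refine tendsto_nhdsWithin_iff.2 ⟨?_, ?_⟩
    · have := Real.continuous_sqrt.tendsto 0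
      rw [Real.sqrt_zero] at this
      exact this.mono_left nhdsWithin_le_nhds
    · filter_upwards [self_mem_nhdsWithin] with K hK using Real.sqrt_pos.2 hK
  have h2 : Tendsto (fun K => Real.log (Real.sqrt K)⁻¹ / 4) (𝓝[>] 0) atTop :=
    ((Real.tendsto_log_atTop.comp tendsto_inv_nhdsGT_zero).comp h1).atTop_div_const four_pos
  refine tendsto_atTop_mono' _ ?_ h2
  filter_upwards [Ioc_mem_nhdsGT one_pos] with K hK using log_le_halfTurn hδ1 hK.1 hK.2

end

/-! ### From the first integral K to the parameter μ. -/

/-- `f` decreases from `+∞` to `0` on the half-line above `a`. -/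
structure IsDecreasingBijection (f : ℝ → ℝ) (a : ℝ) : Prop where
  strictAntiOn : StrictAntiOn f (Ioi a)
  bijOn : BijOn f (Ioi a) (Ioi 0)
  tendsto_atTop : Tendsto f atTop (𝓝 0)
  tendsto_nhdsGT : Tendsto f (𝓝[>] a) atTop

theorem isDecreasingBijection_halfTurn {δ : ℝ} (hδ : 0 ≤ δ) (hδ1 : δ ≤ 1) :
    IsDecreasingBijection (halfTurn δ) 0 where
  strictAntiOn := strictAntiOn_halfTurn hδ
  bijOn := ⟨fun _ hK => halfTurn_pos hK, (strictAntiOn_halfTurn hδ).injOn,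
    isPreconnected_Ioi.intermediate_value_Ioi (l₁ := atTop) (l₂ := 𝓝[>] 0)
      (le_principal_iff.2 (Ioi_mem_atTop 0)) (le_principal_iff.2 self_mem_nhdsWithin)
      continuousOn_halfTurn tendsto_halfTurn_atTop (tendsto_halfTurn_zero hδ1)⟩
  tendsto_atTop := tendsto_halfTurn_atTop
  tendsto_nhdsGT := tendsto_halfTurn_zero hδ1

/-- The first integral `K` of the angle equation for the parameter `±t`, where `1 / 2 < t`. -/
noncomputable def firstIntegral (t : ℝ) : ℝ := (t - 1 / 2) ^ 2 / (2 * t)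

theorem firstIntegral_pos {t : ℝ} (ht : 1 / 2 < t) : 0 < firstIntegral t :=
  div_pos (pow_pos (by linarith) 2) (by linarith)

theorem firstIntegral_eq {t : ℝ} (ht : 1 / 2 < t) :
    firstIntegral t = t / 2 - 1 / 2 + (8 * t)⁻¹ := by
  have : t ≠ 0 := by linarith
  unfold firstIntegral
  field_simp
  ring

theorem strictMonoOn_firstIntegral : StrictMonoOn firstIntegral (Ioi (1 / 2)) := by
  intro s (hs : 1 / 2 < s) t (ht : 1 / 2 < t) hst
  unfold firstIntegral
  rw [div_lt_div_iff₀ (by linarith) (by linarith)]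
  have h1 : 1 / 4 < s * t := by nlinarith
  nlinarith [mul_pos (sub_pos.2 hst) (sub_pos.2 h1)]

theorem surjOn_firstIntegral : SurjOn firstIntegral (Ioi (1 / 2)) (Ioi 0) := by
  intro K (hK : 0 < K)
  have hs := Real.sq_sqrt (show 0 ≤ K ^ 2 + K by positivity)
  have h0 := Real.sqrt_nonneg (K ^ 2 + K)
  -- The larger root of (t - 1/2)² = 2Kt.
  refine ⟨K + 1 / 2 + Real.sqrt (K ^ 2 + K), by simp only [mem_Ioi]; linarith, ?_⟩
  rw [firstIntegral, div_eq_iff (by linarith)]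
  linear_combination hs

theorem IsDecreasingBijection.comp_firstIntegral {f : ℝ → ℝ} (h : IsDecreasingBijection f 0) :
    IsDecreasingBijection (f ∘ firstIntegral) (1 / 2) where
  strictAntiOn := h.strictAntiOn.comp_strictMonoOn strictMonoOn_firstIntegral
    fun _ ht => firstIntegral_pos ht
  bijOn := h.bijOn.comp ⟨fun _ ht => firstIntegral_pos ht, strictMonoOn_firstIntegral.injOn,
    surjOn_firstIntegral⟩
  tendsto_atTop := by
    refine h.tendsto_atTop.comp (tendsto_atTop_mono' atTop (f₁ := fun t => t / 2 - 1 / 2) ?_ ?_)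
    · filter_upwards [eventually_gt_atTop (1 / 2)] with t ht
      rw [firstIntegral_eq ht]
      have : 0 < (8 * t)⁻¹ := inv_pos.2 (by linarith)
      linarith
    · exact tendsto_atTop_add_const_right _ _ (tendsto_id.atTop_div_const two_pos)
  tendsto_nhdsGT := by
    refine h.tendsto_nhdsGT.comp (tendsto_nhdsWithin_iff.2 ⟨?_, ?_⟩)
    · have : ContinuousAt firstIntegral (1 / 2) := by
        unfold firstIntegral
        exact ContinuousAt.div (by fun_prop) (by fun_prop) (by norm_num)
      have h0 : firstIntegral (1 / 2) = 0 := by norm_num [firstIntegral]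
      rw [ContinuousAt, h0] at this
      exact this.mono_left nhdsWithin_le_nhds
    · filter_upwards [self_mem_nhdsWithin] with t ht using firstIntegral_pos ht

theorem IsDecreasingBijection.congr {f g : ℝ → ℝ} {a : ℝ} (h : IsDecreasingBijection f a)
    (hfg : EqOn f g (Ioi a)) : IsDecreasingBijection g a where
  strictAntiOn := h.strictAntiOn.congr hfg
  bijOn := h.bijOn.congr hfg
  tendsto_atTop := h.tendsto_atTop.congr' (hfg.eventuallyEq_of_mem (Ioi_mem_atTop a))
  tendsto_nhdsGT := h.tendsto_nhdsGT.congr' (hfg.eventuallyEq_of_mem self_mem_nhdsWithin)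

/-- The distance between successive vertical geodesics in the surface of parameter `μ`. -/
noncomputable def period (μ : ℝ) : ℝ := halfTurn (if 0 < μ then 0 else 1) (firstIntegral |μ|)

theorem period_of_pos {μ : ℝ} (h : 0 < μ) : period μ = halfTurn 0 (firstIntegral μ) := by
  rw [period, if_pos h, abs_of_pos h]

theorem period_neg_of_pos {μ : ℝ} (h : 0 < μ) : period (-μ) = halfTurn 1 (firstIntegral μ) := by
  rw [period, if_neg (by linarith), abs_neg, abs_of_pos h]

theorem period_pos {μ : ℝ} (h : 1 / 2 < |μ|) : 0 < period μ := halfTurn_pos (firstIntegral_pos h)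

theorem isDecreasingBijection_period : IsDecreasingBijection period (1 / 2) :=
  (isDecreasingBijection_halfTurn le_rfl zero_le_one).comp_firstIntegral.congr
    fun μ (hμ : 1 / 2 < μ) => (period_of_pos (by linarith)).symm

theorem isDecreasingBijection_period_neg :
    IsDecreasingBijection (fun μ => period (-μ)) (1 / 2) :=
  (isDecreasingBijection_halfTurn zero_le_one le_rfl).comp_firstIntegral.congr
    fun μ (hμ : 1 / 2 < μ) => (period_neg_of_pos (by linarith)).symm

/-! ### Solutions of the angle equation -/

open Nil3 in
theorem Nil3.IsHelicoidAngle.neg {θ ρ : ℝ → ℝ} {ε D : ℝ} (h : IsHelicoidAngle θ ρ ε D) :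
    IsHelicoidAngle (fun v => -θ v) (fun v => -ρ v) (-ε) D where
  rate_pos v := by simpa using h.rate_pos v
  surjective y := by
    obtain ⟨v, hv⟩ := h.surjective (-y)
    exact ⟨v, by simp [hv]⟩
  cos_eq_zero_iff v := by rw [Real.cos_neg, h.cos_eq_zero_iff]
  reflect b hb v := by
    rw [Real.cos_neg] at hb
    rw [h.reflect b hb]
    ring

/-- Periodicity and evenness of the speed make the travel time odd and additive over half turns, so
π/2 + kπ is reached at (k + 1/2)D. They also make the speed symmetric about these angles, which
gives the reflection law. -/
theorem exists_isHelicoidAngle {F : ℝ → ℝ} (hF : Continuous F) (hpos : ∀ x, 0 < F x) {M : ℝ}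
    (hM : ∀ x, F x ≤ M) (hper : Function.Periodic F Real.pi) (heven : ∀ x, F (-x) = F x) :
    ∃ x : ℝ → ℝ, x 0 = 0 ∧ (∀ v, HasDerivAt x (F (x v)) v) ∧
      Nil3.IsHelicoidAngle x (fun v => F (x v)) 1 (travelTime F Real.pi) := by
  obtain ⟨x, hx, hVx, hxV⟩ := exists_autonomous_solution hF hpos hM
  have hodd : ∀ y, travelTime F (-y) = -travelTime F y := fun y => by
    have := travelTime_reflect hF hpos (A := 0) (by simpa using heven) y
    simpa [travelTime_zero] using this
  have hhalf : travelTime F (Real.pi / 2) = travelTime F Real.pi / 2 := by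
    have := travelTime_add_int_mul hF hpos hper (-(Real.pi / 2)) 1
    rw [hodd, Int.cast_one, one_mul, one_mul, show -(Real.pi / 2) + Real.pi = Real.pi / 2 by ring]
      at this
    linarith
  have hzero : ∀ k : ℤ, travelTime F ((2 * k + 1) * Real.pi / 2) =
      ((k : ℝ) + 1 / 2) * travelTime F Real.pi := fun k => by
    rw [show (2 * (k : ℝ) + 1) * Real.pi / 2 = Real.pi / 2 + k * Real.pi by ring,
      travelTime_add_int_mul hF hpos hper, hhalf]
    ring
  refine ⟨x, ?_, hx, fun v => by simpa using hpos _, fun y => ⟨_, hxV y⟩, fun v => ?_,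
    fun b hb v => ?_⟩
  · simpa [travelTime_zero] using hxV 0
  · rw [Real.cos_eq_zero_iff]
    refine exists_congr fun k => ⟨fun h => ?_, fun h => ?_⟩
    · rw [← hzero, ← h, hVx]
    · rw [h, ← hzero, hxV]
  · obtain ⟨k, hk⟩ := Real.cos_eq_zero_iff.1 hb
    have hA : ∀ y, F (2 * x b - y) = F y := fun y => by
      rw [hk, show 2 * ((2 * (k : ℝ) + 1) * Real.pi / 2) - y =
        -y + ((2 * k + 1 : ℤ) : ℝ) * Real.pi by push_cast; ring, hper.int_mul _ _, heven]
    have := travelTime_reflect hF hpos hA (x v)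
    rw [hVx, hVx] at this
    rw [← this, hxV]

/-- Here the first integral equals K > 0, and ρ is the root K + c + √(K(K + c)) of (ρ - c)² = K(2ρ -
c). -/
theorem exists_angle_of_gt {μ : ℝ} (hμ : 1 / 2 < μ) :
    ∃ θ ρ : ℝ → ℝ, IsAngle μ θ ρ ∧ Nil3.IsHelicoidAngle θ ρ 1 (period μ) := by
  set K := firstIntegral μ with hK
  have hK0 : 0 < K := firstIntegral_pos hμ
  have hK2 : K * (2 * μ) = (μ - 1 / 2) ^ 2 := div_mul_cancel₀ _ (by linarith)
  -- With ρ ≤ 2K + 2 this gives the bound 2 + |μ|.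
  have hKμ : 2 * K ≤ μ := by nlinarith
  obtain ⟨θ, h0, hθ, hH⟩ := exists_isHelicoidAngle (F := fun x => turnRate 0 K (Real.cos x ^ 2))
    (by unfold turnRate; fun_prop) (fun x => turnRate_pos hK0 (sq_nonneg _))
    (fun x => turnRate_le hK0 zero_le_one (sq_nonneg _) (Real.cos_sq_le_one x))
    (fun x => by simp [Real.cos_add_pi]) (fun x => by simp)
  rw [← halfTurn_eq_cos, hK, ← period_of_pos (by linarith), ← hK] at hH
  refine ⟨θ, _, ⟨h0, ?_, hθ, fun v => ?_, fun v => ?_⟩, hH⟩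
  -- At θ = 0 the radicand is a perfect square, because K + 1 = (μ + 1/2)² / (2μ).
  · have : Real.sqrt ((K + 0) * (K + 1)) = (μ - 1 / 2) * (μ + 1 / 2) / (2 * μ) := by
      refine (Real.sqrt_eq_iff_mul_self_eq_of_pos ?_).2 ?_
      · exact div_pos (mul_pos (by linarith) (by linarith)) (by linarith)
      · have : μ ≠ 0 := by linarith
        rw [hK, firstIntegral]
        field_simp
        ring
    simp only [h0, Real.cos_zero, one_pow, turnRate, this]
    have : μ ≠ 0 := by linarith
    rw [hK, firstIntegral]
    field_simp
    ring
  · have hc : 0 ≤ Real.cos (θ v) ^ 2 := sq_nonneg _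
    have hP : 0 < (K + 0) * (K + Real.cos (θ v) ^ 2) :=
      mul_pos (by linarith) (by linarith)
    refine (hasDerivAt_turnRate ((hθ v).cos.pow 2) hP.ne').congr_deriv ?_
    have hS := Real.sq_sqrt hP.le
    have hS0 := Real.sqrt_pos.2 hP
    simp only [turnRate]
    generalize Real.sqrt ((K + 0) * (K + Real.cos (θ v) ^ 2)) = S at *
    field_simp
    linear_combination 2 * Real.sin (θ v) * Real.cos (θ v) * hS
  · rw [abs_of_pos (turnRate_pos hK0 (sq_nonneg _)), abs_of_pos (by linarith)]
    linarith [turnRate_le hK0 zero_le_one (sq_nonneg _) (Real.cos_sq_le_one (θ v))]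

/-- With ν = -μ and K = `firstIntegral ν`, the first integral equals -(K + 1). In terms of x = -θ
and s = sin² x the relation has the root x' = K + s + √((K + 1)(K + s)). -/
theorem exists_angle_of_lt {μ : ℝ} (hμ : μ < -1 / 2) :
    ∃ θ ρ : ℝ → ℝ, IsAngle μ θ ρ ∧ Nil3.IsHelicoidAngle θ ρ (-1) (period μ) := by
  obtain ⟨ν, rfl⟩ : ∃ ν, μ = -ν := ⟨-μ, by ring⟩
  replace hμ : 1 / 2 < ν := by linarith
  set K := firstIntegral ν with hK
  have hK0 : 0 < K := firstIntegral_pos hμ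
  have hK2 : K * (2 * ν) = (ν - 1 / 2) ^ 2 := div_mul_cancel₀ _ (by linarith)
  have hKμ : 2 * K ≤ ν := by nlinarith
  obtain ⟨x, h0, hx, hH⟩ := exists_isHelicoidAngle (F := fun x => turnRate 1 K (Real.sin x ^ 2))
    (by unfold turnRate; fun_prop) (fun x => turnRate_pos hK0 (sq_nonneg _))
    (fun x => turnRate_le hK0 le_rfl (sq_nonneg _) (Real.sin_sq_le_one x))
    (fun x => by simp [Real.sin_add_pi]) (fun x => by simp)
  change Nil3.IsHelicoidAngle _ _ _ (halfTurn 1 K) at hH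
  rw [hK, ← period_neg_of_pos (by linarith), ← hK] at hH
  refine ⟨_, _, ⟨by simp [h0], ?_, fun v => (hx v).fun_neg, fun v => ?_, fun v => ?_⟩, hH.neg⟩
  · have : Real.sqrt ((K + 1) * (K + 0)) = (ν - 1 / 2) * (ν + 1 / 2) / (2 * ν) := by
      refine (Real.sqrt_eq_iff_mul_self_eq_of_pos ?_).2 ?_
      · exact div_pos (mul_pos (by linarith) (by linarith)) (by linarith)
      · have : ν ≠ 0 := by linarith
        rw [hK, firstIntegral]
        field_simp
        ring
    simp only [h0, Real.sin_zero, ne_eq, OfNat.ofNat_ne_zero, not_false_eq_true, zero_pow,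
      turnRate, this]
    have : ν ≠ 0 := by linarith
    rw [hK, firstIntegral]
    field_simp
    ring
  · have hc : 0 ≤ Real.sin (x v) ^ 2 := sq_nonneg _
    have hP : 0 < (K + 1) * (K + Real.sin (x v) ^ 2) :=
      mul_pos (by linarith) (by linarith)
    refine (hasDerivAt_turnRate ((hx v).sin.pow 2) hP.ne').fun_neg.congr_deriv ?_
    have hS := Real.sq_sqrt hP.le
    have hS0 := Real.sqrt_pos.2 hP
    simp only [turnRate, Real.sin_neg, Real.cos_neg, Real.cos_sq']
    generalize Real.sqrt ((K + 1) * (K + Real.sin (x v) ^ 2)) = S at *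
    field_simp
    linear_combination 2 * Real.sin (x v) * Real.cos (x v) * hS
  · rw [abs_neg, abs_neg, abs_of_pos (turnRate_pos hK0 (sq_nonneg _)),
      abs_of_pos (show 0 < ν by linarith)]
    linarith [turnRate_le hK0 le_rfl (sq_nonneg _) (Real.sin_sq_le_one (x v))]

/-- For g = tan θ one has ρ = g' cos² θ, and the relation 2μ(ρ - c)² = b²(2ρ - c), cleared of
denominators so that μ = 0 is included, becomes g' = s/(s + b) with s² = a² cos² θ + b² sin² θ. This
speed is at most 1, so g is global. -/
theorem exists_angle_of_abs_le {μ : ℝ} (h1 : -1 / 2 ≤ μ) (h2 : μ ≤ 1 / 2) :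
    ∃ θ ρ : ℝ → ℝ, IsAngle μ θ ρ ∧ ∀ v, Real.cos (θ v) ≠ 0 := by
  -- At μ = -1/2 one has a = 0 and the speed vanishes at g = 0, so the travel time is unavailable;
  -- the solution is θ = 0.
  rcases h1.eq_or_lt with rfl | h1
  · refine ⟨fun _ => 0, fun _ => 0, ⟨rfl, by norm_num, fun v => hasDerivAt_const _ _,
      fun v => ?_, fun v => ?_⟩, fun v => by simp⟩
    · simpa using hasDerivAt_const v (0 : ℝ)
    · simp; positivity
  obtain ⟨a, ha⟩ : ∃ a, a = μ + 1 / 2 := ⟨_, rfl⟩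
  obtain ⟨b, hb⟩ : ∃ b, b = 1 / 2 - μ := ⟨_, rfl⟩
  have ha0 : 0 < a := by linarith
  have hb0 : 0 ≤ b := by linarith
  have hab : a + b = 1 := by linarith
  have hq : ∀ g : ℝ, 0 < 1 + g ^ 2 := fun g => by positivity
  have hP : ∀ g : ℝ, 0 < (b ^ 2 * g ^ 2 + a ^ 2) / (1 + g ^ 2) := fun g => by positivity
  set s : ℝ → ℝ := fun g => Real.sqrt ((b ^ 2 * g ^ 2 + a ^ 2) / (1 + g ^ 2)) with hs
  have hs0 : ∀ g, 0 < s g := fun g => Real.sqrt_pos.2 (hP g)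
  have hs2 : ∀ g, s g ^ 2 * (1 + g ^ 2) = b ^ 2 * g ^ 2 + a ^ 2 := fun g => by
    rw [hs, Real.sq_sqrt (hP g).le, div_mul_cancel₀ _ (hq g).ne']
  have hsc : Continuous s := by
    refine Real.continuous_sqrt.comp (Continuous.div (by fun_prop) (by fun_prop) fun g => (hq g).ne')
  have hle : ∀ g, s g / (s g + b) ≤ 1 := fun g =>
    div_le_one_of_le₀ (by linarith) (by linarith [hs0 g])
  obtain ⟨g, hg, -, hg0⟩ := exists_autonomous_solution (F := fun g => s g / (s g + b))
    (hsc.div (by fun_prop) fun g => by linarith [hs0 g] |> ne_of_gt)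
    (fun g => div_pos (hs0 g) (by linarith [hs0 g])) hle
  replace hg0 : g 0 = 0 := by simpa [travelTime_zero] using hg0 0
  have hθ : ∀ v, HasDerivAt (fun v => Real.arctan (g v))
      (1 / (1 + g v ^ 2) * (s (g v) / (s (g v) + b))) v := fun v => (hg v).arctan
  refine ⟨_, _, ⟨by simp [hg0], ?_, hθ, fun v => ?_, fun v => ?_⟩,
    fun v => (Real.cos_arctan_pos _).ne'⟩
  · have : s 0 = a := by simp [hs, Real.sqrt_sq ha0.le]
    simp only [hg0, this, hab]
    simp [ha]
  · have hsd : HasDerivAt (fun v => s (g v))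
        (-((s (g v) ^ 2 - b ^ 2) * g v * (s (g v) / (s (g v) + b))) / (s (g v) * (1 + g v ^ 2)))
        v := by
      refine (((((hg v).pow 2).const_mul (b ^ 2)).add_const (a ^ 2)).fun_div
        (((hg v).pow 2).const_add 1) (hq (g v)).ne').sqrt (hP (g v)).ne' |>.congr_deriv ?_
      change _ / (2 * s (g v)) = _
      simp only [Pi.pow_apply]
      have h3 := hs0 (g v)
      have h4 := hs2 (g v)
      have h5 := hq (g v)
      generalize s (g v) = S at *
      generalize g v = G at *
      have h6 : S + b ≠ 0 := by linarith
      field_simp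
      linear_combination 2 * G * h4
    have hsum : s (g v) + b ≠ 0 := by linarith [hs0 (g v)]
    refine ((hasDerivAt_const v (1 : ℝ)).fun_div (((hg v).pow 2).const_add 1)
      (hq (g v)).ne').mul (hsd.fun_div (hsd.add_const b) hsum) |>.congr_deriv ?_
    have hsc : Real.sin (Real.arctan (g v)) * Real.cos (Real.arctan (g v)) =
        g v / (1 + g v ^ 2) := by
      rw [Real.sin_arctan, Real.cos_arctan, div_mul_div_comm, mul_one,
        Real.mul_self_sqrt (hq _).le]
    rw [hsc, Real.cos_sq_arctan]
    simp only [Pi.pow_apply]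
    have h3 := hs0 (g v)
    have h5 := hq (g v)
    generalize s (g v) = S at *
    generalize g v = G at *
    field_simp
    ring
  · have h3 := hs0 (g v)
    have h4 : 0 ≤ 1 / (1 + g v ^ 2) * (s (g v) / (s (g v) + b)) :=
      mul_nonneg (by positivity) (div_nonneg h3.le (by linarith))
    rw [abs_of_nonneg h4]
    have h5 : 1 / (1 + g v ^ 2) ≤ 1 :=
      div_le_one_of_le₀ (by linarith [sq_nonneg (g v)]) (hq _).le
    have := mul_le_one₀ h5 (div_nonneg h3.le (by linarith)) (hle (g v))
    linarith [abs_nonneg μ]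

theorem exists_angle (μ : ℝ) : ∃ θ ρ : ℝ → ℝ, IsAngle μ θ ρ ∧
    (-1 / 2 ≤ μ → μ ≤ 1 / 2 → ∀ v, Real.cos (θ v) ≠ 0) ∧
    (1 / 2 < μ → Nil3.IsHelicoidAngle θ ρ 1 (period μ)) ∧
    (μ < -1 / 2 → Nil3.IsHelicoidAngle θ ρ (-1) (period μ)) := by
  rcases lt_or_ge (1 / 2) μ with h | h
  · obtain ⟨θ, ρ, hθ, hH⟩ := exists_angle_of_gt h
    exact ⟨θ, ρ, hθ, fun _ h' => absurd h h'.not_gt, fun _ => hH, fun h' => by linarith⟩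
  rcases lt_or_ge μ (-1 / 2) with h' | h'
  · obtain ⟨θ, ρ, hθ, hH⟩ := exists_angle_of_lt h'
    exact ⟨θ, ρ, hθ, fun h _ => absurd h' h.not_gt, fun h => by linarith, fun _ => hH⟩
  · obtain ⟨θ, ρ, hθ, hc⟩ := exists_angle_of_abs_le h' h
    exact ⟨θ, ρ, hθ, fun _ _ => hc, fun h => by linarith, fun h => by linarith⟩

theorem lemma3p2 :
    Nil3.IsHorizontalGeodesic Nil3.axis ∧
    ∃ (Φ : ℝ → ℝ × ℝ → Nil3) (D : ℝ → ℝ),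
      Nil3.IsContinuousFamily Φ ∧
      (∀ μ : ℝ,
        Nil3.IsProperEmbedding (Φ μ) ∧
        Nil3.IsCompleteSurface (Φ μ) ∧
        Nil3.IsMinimal (Φ μ) ∧
        Nil3.IsFoliatedByOrthogonalLines (range (Φ μ)) Nil3.axis ∧
        Nil3.ContainsOrthogonalHorizontalGeodesic (range (Φ μ)) Nil3.axis ∧
        Nil3.HasInitialRotation (range (Φ μ)) μ) ∧
      (∀ μ : ℝ, -1 / 2 ≤ μ → μ ≤ 1 / 2 → Nil3.IsEntireGraph (range (Φ μ))) ∧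
      (∀ μ : ℝ, 1 / 2 < μ → Nil3.IsHorizontalHelicoid (range (Φ μ)) Nil3.axis 1) ∧
      (∀ μ : ℝ, μ < -1 / 2 → Nil3.IsHorizontalHelicoid (range (Φ μ)) Nil3.axis (-1)) ∧
      (∀ μ : ℝ, 1 / 2 < |μ| →
        {L : Set Nil3 | Nil3.IsVerticalGeodesic L ∧ L ⊆ range (Φ μ)} =
          range (fun k : ℤ => Nil3.fibre 0 (((k : ℝ) + 1 / 2) * D μ)) ∧
        ∀ k : ℤ, Nil3.setDist (Nil3.fibre 0 (((k : ℝ) + 1 / 2) * D μ))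
          (Nil3.fibre 0 (((k : ℝ) + 3 / 2) * D μ)) = ENNReal.ofReal (D μ)) ∧
      StrictAntiOn D (Ioi (1 / 2)) ∧ BijOn D (Ioi (1 / 2)) (Ioi 0) ∧
      Tendsto D atTop (𝓝 0) ∧ Tendsto D (𝓝[>] (1 / 2)) atTop ∧
      StrictMonoOn D (Iio (-1 / 2)) ∧ BijOn D (Iio (-1 / 2)) (Ioi 0) ∧
      Tendsto D atBot (𝓝 0) ∧ Tendsto D (𝓝[<] (-1 / 2)) atTop := by
  choose θ ρ hθ hgraph hpos hneg using exists_angle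
  have hp := isDecreasingBijection_period
  have hn := isDecreasingBijection_period_neg
  -- On the negative side everything is transported by μ ↦ -μ, which turns decreasing into
  -- increasing.
  have hneg_neg : (fun μ => period (-μ)) ∘ Neg.neg = period := by
    funext μ; simp
  have hmaps : MapsTo Neg.neg (Iio (-1 / 2 : ℝ)) (Ioi (1 / 2)) := fun μ (hμ : μ < -1 / 2) => by
    simp only [mem_Ioi]; linarith
  refine ⟨Nil3.isHorizontalGeodesic_axis, fun μ => Nil3.ruled (θ μ), period,
    Nil3.isContinuousFamily_ruled hθ, fun μ => ⟨Nil3.isProperEmbedding_ruled (hθ μ),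
      Nil3.isCompleteSurface_ruled (hθ μ), Nil3.isMinimal_ruled (hθ μ),
      Nil3.isFoliatedByOrthogonalLines_ruled (hθ μ).contDiff_prod.fst,
      Nil3.containsOrthogonalHorizontalGeodesic_ruled (hθ μ).zero,
      Nil3.hasInitialRotation_ruled (hθ μ)⟩,
    fun μ h1 h2 => Nil3.isEntireGraph_ruled (hθ μ).contDiff_prod.fst (hgraph μ h1 h2),
    fun μ h => (hpos μ h).isHorizontalHelicoid (hθ μ),
    fun μ h => (hneg μ h).isHorizontalHelicoid (hθ μ),
    fun μ h => ⟨?_, Nil3.setDist_successive_fibre (period_pos h).le⟩,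
    hp.strictAntiOn, hp.bijOn, hp.tendsto_atTop, hp.tendsto_nhdsGT, ?_, ?_, ?_, ?_⟩
  · rcases lt_abs.1 h with h | h
    · exact (hpos μ h).verticalGeodesics
    · exact (hneg μ (by linarith)).verticalGeodesics
  · intro μ hμ ν hν h
    simpa using hn.strictAntiOn (hmaps hν) (hmaps hμ) (neg_lt_neg h)
  · rw [← hneg_neg]
    exact hn.bijOn.comp ⟨hmaps, neg_injective.injOn, fun μ (hμ : 1 / 2 < μ) =>
      ⟨-μ, by simp only [mem_Iio]; linarith, neg_neg μ⟩⟩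
  · rw [← hneg_neg]
    exact hn.tendsto_atTop.comp tendsto_neg_atBot_atTop
  · rw [← hneg_neg]
    refine hn.tendsto_nhdsGT.comp (tendsto_nhdsWithin_iff.2 ⟨?_, ?_⟩)
    · have := (continuous_neg (G := ℝ)).tendsto (-1 / 2)
      rw [show -(-1 / 2 : ℝ) = 1 / 2 by norm_num] at this
      exact this.mono_left nhdsWithin_le_nhds
    · filter_upwards [self_mem_nhdsWithin] with μ hμ using hmaps hμ
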